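/- Let $(E,d)$ be a compact metric space and let $\{P_r(x,\mathrm dy)\}_{r\ge 0}$ be a time-homogeneous Markov transition function on $E$ such that $S(r)f(x)=\int f(y)\,P_r(x,\mathrm dy)$ defines a strongly continuous semigroup on $(C(E),\|\cdot\|_\infty)$, with infinitesimal generator $(A,\mathcal D(A))$. Put $V(r)f=\log S(r)e^f$. Let $D\subseteq\mathcal D(A)$ be a linear subspace that is a core for $A$ and is dense in $C(E)$, such that $fg\in D$ for $f,g\in D$ and $\phi\circ f\in D$ for $f\in D$ and $\phi$ smooth on the range of $f$. Let $\tau_D$ be a topology on $D$ such that (a) $(D,\tau_D)$ is a separable barrelled locally convex Hausdorff space; (b) $\tau_D$ is finer than the sup-norm topology; (c) $f\mapsto e^f-1$ and $(f,g)\mapsto fg$ are continuous for $\tau_D$; (d) $S(r)D\subseteq D$ and $V(r)D\subseteq D$ for all $r\ge0$, and both semigroups restricted to $D$ are strongly continuous for $\tau_D$ (each operator is continuous $(D,\tau_D)\to(D,\tau_D)$, and all orbits $r\mapsto S(r)f$, $r\mapsto V(r)f$ are continuous); (e) $A:(D,\tau_D)\to(C(E),\|\cdot\|_\infty)$ is continuous;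 (f) with $Hf=e^{-f}Ae^f$, there is a barrel $\mathcal N\subseteq D$ with $\sup_{f\in\mathcal N}\|Hf\|\le1$ and $\sup_{f\in c\mathcal N}\|Hf\|<\infty$ for every $c>0$. Let $D'$ be the continuous dual of $(D,\tau_D)$ and, for a probability measure $\mu$ on $E$ and $u\in D'$, let $$\mathcal L(\mu,u)=\sup_{f\in D}\{\langle f,u\rangle-\langle Hf,\mu\rangle\}.$$ A weakly continuous curve $\nu:[0,\infty)\to\mathcal P(E)$ is called absolutely continuous if there is a weak* measurable curve $u:[0,\infty)\to D'$ with $\int_0^r|\langle f,u(s)\rangle|\,\mathrm ds<\infty$ and $\langle f,\nu(r)\rangle-\langle f,\nu(0)\rangle=\int_0^r\langle f,u(s)\rangle\,\mathrm ds$ for all $f\in D$, $r\ge0$; any such $u$ is denoted $\dot\nu$. The relative entropy is $H(\mu\,|\,\nu)=\int\log\frac{\mathrm d\mu}{\mathrm d\nu}\,\mathrm d\mu$ if $\mu\ll\nu$, and $+\infty$ otherwise. Let $\mathbb P$ be the law, on the space $D_E(\mathbb R^+)$ of càdlàg paths, of a Markov process $X$ with this transition function and initial law $\mathbb P_0$.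 Let $t\ge0$, $h\in D$, and let $\rho_0:E\to[0,\infty)$ be measurable such that $$\frac{\mathrm d\mathbb Q}{\mathrm d\mathbb P}(X)=\rho_0(X(0))\,e^{h(X(t))}$$ defines a probability measure $\mathbb Q$ on $D_E(\mathbb R^+)$. Let $\gamma(s)$ be the law of $X(s)$ under $\mathbb Q$, let $\mathbb Q_0=\gamma(0)$, and let $\mathbb P^{\gamma(0)}$ be the Markov measure on $D_E(\mathbb R^+)$ with the same transition function and initial law $\gamma(0)$. Then $\mathbb P^{\gamma(0)}$ exists, the curve $\gamma$ is absolutely continuous, and, for every choice of $\dot\gamma$, $$H(\mathbb Q\,|\,\mathbb P)=H(\mathbb Q_0\,|\,\mathbb P_0)+H(\mathbb Q\,|\,\mathbb P^{\gamma(0)})=H(\mathbb Q_0\,|\,\mathbb P_0)+\int_0^t\mathcal L(\gamma(s),\dot\gamma(s))\,\mathrm ds,$$ as an identity in $[0,\infty]$. -/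

import Mathlib

open MeasureTheory ProbabilityTheory Filter Topology
open scoped NNReal ENNReal Pointwise

noncomputable section

namespace DoobEntropy

/-! ### Path space -/

/-- `D_E(ℝ⁺)`: right-continuous paths `[0,∞) → E` with left limits. -/
def CadlagPath (E : Type*) [TopologicalSpace E] : Type _ :=
  {x : ℝ≥0 → E // ∀ t, ContinuousWithinAt x (Set.Ici t) t ∧ ∃ l, Tendsto x (𝓝[<] t) (𝓝 l)}

namespace CadlagPath

variable {E : Type*} [TopologicalSpace E]

/-- The coordinate `X(t)`. -/
def eval (t : ℝ≥0) (X : CadlagPath E) : E := X.1 t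

variable [MeasurableSpace E]

/-- The σ-algebra generated by the coordinates `X(t)`, `t ≥ 0`; for separable metric `E` it is
the Borel σ-algebra of the Skorokhod topology. -/
instance : MeasurableSpace (CadlagPath E) :=
  Subtype.instMeasurableSpace

theorem measurable_eval (t : ℝ≥0) : Measurable (eval t : CadlagPath E → E) :=
  (measurable_pi_apply t).comp measurable_subtype_coe

/-- The law of `X(t)` under a probability measure `Q` on path space. -/
def law (Q : Measure (CadlagPath E)) [IsProbabilityMeasure Q] (t : ℝ≥0) : ProbabilityMeasure E :=
  ⟨Q.map (eval t), Measure.isProbabilityMeasure_map (measurable_eval t).aemeasurable⟩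

/-- The natural filtration `σ(X(s), s ≤ t)`. -/
def pathFiltration (E : Type*) [MetricSpace E] [CompactSpace E] [MeasurableSpace E]
    [BorelSpace E] : Filtration ℝ≥0 (inferInstance : MeasurableSpace (CadlagPath E)) :=
  Filtration.natural (fun t => eval t) fun t => (measurable_eval t).stronglyMeasurable

end CadlagPath

/-! ### Feller transition functions, semigroup and generator -/

/-- A time-homogeneous Markov transition function on `E` whose operators `S(t)` map `C(E)` to
`C(E)` and are strongly continuous for the sup norm. -/
structure FellerTransition (E : Type*) [MetricSpace E] [CompactSpace E] [MeasurableSpace E]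
    [BorelSpace E] where
  kernel : ℝ≥0 → Kernel E E
  isMarkov : ∀ t, IsMarkovKernel (kernel t)
  kernel_zero : kernel 0 = Kernel.id
  kernel_add : ∀ s t, kernel (s + t) = kernel t ∘ₖ kernel s
  feller : ∀ t (f : C(E, ℝ)), Continuous fun x => ∫ y, f y ∂(kernel t x)
  strongly_continuous : ∀ f : C(E, ℝ),
    Continuous fun t => (⟨fun x => ∫ y, f y ∂(kernel t x), feller t f⟩ : C(E, ℝ))

/-- `e^f` as an element of `C(E)`. -/
def expC {E : Type*} [TopologicalSpace E] (f : C(E, ℝ)) : C(E, ℝ) :=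
  ⟨fun x => Real.exp (f x), Real.continuous_exp.comp f.continuous⟩

namespace FellerTransition

variable {E : Type*} [MetricSpace E] [CompactSpace E] [MeasurableSpace E] [BorelSpace E]
  (T : FellerTransition E)

/-- The semigroup `S(t) f(x) = 𝔼[f(X(t)) | X(0) = x]`. -/
def S (t : ℝ≥0) (f : C(E, ℝ)) : C(E, ℝ) :=
  ⟨fun x => ∫ y, f y ∂(T.kernel t x), T.feller t f⟩

theorem S_expC_pos (t : ℝ≥0) (f : C(E, ℝ)) (x : E) : 0 < T.S t (expC f) x := by
  have := T.isMarkov t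
  have hi : Integrable (fun y => Real.exp (f y)) (T.kernel t x) :=
    (expC f).continuous.integrable_of_hasCompactSupport
      (HasCompactSupport.of_compactSpace _)
  exact integral_exp_pos hi

/-- The non-linear semigroup `V(t) f = log S(t) e^f`. -/
def V (t : ℝ≥0) (f : C(E, ℝ)) : C(E, ℝ) :=
  ⟨fun x => Real.log (T.S t (expC f) x),
    (T.S t (expC f)).continuous.log fun x => (T.S_expC_pos t f x).ne'⟩

/-- The difference quotient `(S(t) f - f) / t`. -/
def quotient (f : C(E, ℝ)) (t : ℝ≥0) : C(E, ℝ) := (t : ℝ)⁻¹ • (T.S t f - f)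

/-- The domain `𝒟(A)` of the infinitesimal generator. -/
def genDomain : Set C(E, ℝ) := {f | ∃ g, Tendsto (T.quotient f) (𝓝[>] 0) (𝓝 g)}

/-- The infinitesimal generator `A`, meaningful on `genDomain`. -/
def gen (f : C(E, ℝ)) : C(E, ℝ) := limUnder (𝓝[>] 0) (T.quotient f)

/-- The Hamiltonian `H f = e^{-f} A e^f`. -/
def hamiltonian (f : C(E, ℝ)) : C(E, ℝ) := expC (-f) * T.gen (expC f)

/-- `P` is the Markov measure on path space with initial law `μ` and transition function `T`. -/
structure IsMarkovMeasure (μ : Measure E) (P : Measure (CadlagPath E)) : Prop where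
  isProb : IsProbabilityMeasure P
  initial : P.map (CadlagPath.eval 0) = μ
  markov : ∀ (s r : ℝ≥0) (f : C(E, ℝ)),
    P[fun X => f (X.eval (s + r)) | CadlagPath.pathFiltration E s]
      =ᵐ[P] fun X => T.S r f (X.eval s)

end FellerTransition

/-! ### The core `D` with its own topology -/

/-- The vector space `D ⊆ C(E)` as a type of its own, without the sup-norm topology, so that it
can carry the topology `τ_D`. -/
def CoreSpace {E : Type*} [TopologicalSpace E] (D : Submodule ℝ C(E, ℝ)) : Type _ := D

namespace CoreSpace

variable {E : Type*} [TopologicalSpace E] (D : Submodule ℝ C(E, ℝ))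

instance : AddCommGroup (CoreSpace D) := inferInstanceAs (AddCommGroup D)

instance : Module ℝ (CoreSpace D) := inferInstanceAs (Module ℝ D)

/-- The inclusion `D → C(E)`. -/
def incl : CoreSpace D →ₗ[ℝ] C(E, ℝ) := D.subtype

/-- The (possibly non-linear) family of operators `W(t)` maps `D` into `D`, and its restriction to
`D` is strongly continuous for `τ_D`: every `W(t) : D → D` and every orbit `t ↦ W(t) f` is
continuous. -/
def RestrictsStronglyContinuously [TopologicalSpace (CoreSpace D)]
    (W : ℝ≥0 → C(E, ℝ) → C(E, ℝ)) : Prop :=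
  ∃ w : ℝ≥0 → CoreSpace D → CoreSpace D,
    (∀ t f, incl D (w t f) = W t (incl D f)) ∧
    (∀ t, Continuous (w t)) ∧ ∀ f, Continuous fun t => w t f

end CoreSpace

section

variable {E : Type*} [MetricSpace E] [CompactSpace E] [MeasurableSpace E] [BorelSpace E]

open CoreSpace

/-- `D` is a core of the generator, dense in `C(E)`, an algebra, and stable under composition with
smooth functions. -/
structure IsSmoothCore (T : FellerTransition E) (D : Submodule ℝ C(E, ℝ)) : Prop where
  subset_domain : ∀ f ∈ D, f ∈ T.genDomain
  core : ∀ f ∈ T.genDomain, ∃ g : ℕ → C(E, ℝ), (∀ n, g n ∈ D) ∧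
    Tendsto g atTop (𝓝 f) ∧ Tendsto (fun n => T.gen (g n)) atTop (𝓝 (T.gen f))
  dense : Dense (D : Set C(E, ℝ))
  mul_mem : ∀ f ∈ D, ∀ g ∈ D, f * g ∈ D
  comp_mem : ∀ f ∈ D, ∀ (φ : ℝ → ℝ) (hφ : ContDiff ℝ (⊤ : ℕ∞) φ),
    (⟨fun x => φ (f x), hφ.continuous.comp f.continuous⟩ : C(E, ℝ)) ∈ D

/-- The conditions on the core `D` with its topology `τ_D`. -/
structure IsTopologicalCore (T : FellerTransition E) (D : Submodule ℝ C(E, ℝ))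
    [TopologicalSpace (CoreSpace D)] : Prop extends IsSmoothCore T D where
  /-- `(D, τ_D)` is a separable barrelled locally convex Hausdorff space. -/
  topologicalAddGroup : IsTopologicalAddGroup (CoreSpace D)
  continuousSMul : ContinuousSMul ℝ (CoreSpace D)
  locallyConvex : LocallyConvexSpace ℝ (CoreSpace D)
  hausdorff : T2Space (CoreSpace D)
  separable : TopologicalSpace.SeparableSpace (CoreSpace D)
  barrelled : BarrelledSpace ℝ (CoreSpace D)
  /-- `τ_D` is finer than the sup-norm topology. -/
  finer : Continuous (incl D)
  /-- `f ↦ e^f - 1` and multiplication are continuous on `D`. -/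
  exp_continuous : ∃ e : CoreSpace D → CoreSpace D,
    (∀ f, incl D (e f) = expC (incl D f) - 1) ∧ Continuous e
  mul_continuous : ∃ m : CoreSpace D × CoreSpace D → CoreSpace D,
    (∀ f g, incl D (m (f, g)) = incl D f * incl D g) ∧ Continuous m
  /-- `S(t)` and `V(t)` restrict to strongly continuous semigroups on `(D, τ_D)`. -/
  S_restricts : RestrictsStronglyContinuously D T.S
  V_restricts : RestrictsStronglyContinuously D T.V
  /-- `A : (D, τ_D) → (C(E), ‖·‖)` is continuous. -/
  gen_continuous : Continuous fun f : CoreSpace D => T.gen (incl D f)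
  /-- There is a barrel on which `‖H f‖ ≤ 1` and on all multiples of which `‖H f‖` is bounded. -/
  barrel : ∃ N : Set (CoreSpace D),
    Convex ℝ N ∧ Balanced ℝ N ∧ Absorbent ℝ N ∧ IsClosed N ∧
    (∀ f ∈ N, ‖T.hamiltonian (incl D f)‖ ≤ 1) ∧
    ∀ c : ℝ, 0 < c → ∃ C : ℝ, ∀ f ∈ c • N, ‖T.hamiltonian (incl D f)‖ ≤ C

/-! ### Absolutely continuous curves and the Lagrangian -/

/-- `u` is a derivative `ν̇` of the curve `ν` of probability measures: `u` is a weak* (Lebesgue)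
measurable curve in `D'`, `s ↦ ⟨f, u(s)⟩` is locally integrable for every `f ∈ D`, and
`ν(t) - ν(0) = ∫₀ᵗ u(s) ds` as a Gelfand integral. -/
structure IsDerivativeOf {D : Submodule ℝ C(E, ℝ)} [TopologicalSpace (CoreSpace D)]
    (u : ℝ≥0 → CoreSpace D →L[ℝ] ℝ) (ν : ℝ≥0 → ProbabilityMeasure E) : Prop where
  measurable : ∀ f : CoreSpace D,
    AEMeasurable (fun s : ℝ => u s.toNNReal f) (volume.restrict (Set.Ici 0))
  integrable : ∀ (f : CoreSpace D) (t : ℝ≥0),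
    ∫⁻ s in Set.Icc (0 : ℝ) t, ‖u s.toNNReal f‖ₑ < ∞
  integral_eq : ∀ (f : CoreSpace D) (t : ℝ≥0),
    (∫ x, incl D f x ∂(ν t : Measure E)) - (∫ x, incl D f x ∂(ν 0 : Measure E))
      = ∫ s in Set.Icc (0 : ℝ) t, u s.toNNReal f

/-- The class `D-𝒜𝒞` of absolutely continuous curves in `𝒫(E)`. -/
def IsAbsolutelyContinuousCurve (D : Submodule ℝ C(E, ℝ)) [TopologicalSpace (CoreSpace D)]
    (ν : ℝ≥0 → ProbabilityMeasure E) : Prop :=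
  Continuous ν ∧ ∃ u : ℝ≥0 → CoreSpace D →L[ℝ] ℝ, IsDerivativeOf u ν

/-- The Lagrangian `ℒ(μ, u) = sup_{f ∈ D} (⟨f, u⟩ - ⟨H f, μ⟩)`. -/
def lagrangian (T : FellerTransition E) {D : Submodule ℝ C(E, ℝ)} [TopologicalSpace (CoreSpace D)]
    (μ : ProbabilityMeasure E) (u : CoreSpace D →L[ℝ] ℝ) : EReal :=
  ⨆ f : CoreSpace D, ((u f - (∫ x, T.hamiltonian (incl D f) x ∂(μ : Measure E)) : ℝ) : EReal)

/-- The cost `∫₀ᵗ ℒ(ν(s), u(s)) ds ∈ [0, ∞]`. On the smooth core the supremum defining `ℒ` is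
nonnegative (take `f = 0`), so `EReal.toENNReal` is only a change of type. -/
def lagrangianCost (T : FellerTransition E) {D : Submodule ℝ C(E, ℝ)}
    [TopologicalSpace (CoreSpace D)] (ν : ℝ≥0 → ProbabilityMeasure E)
    (u : ℝ≥0 → CoreSpace D →L[ℝ] ℝ) (t : ℝ≥0) : ℝ≥0∞ :=
  ∫⁻ s in Set.Icc (0 : ℝ) t, (lagrangian T (ν s.toNNReal) (u s.toNNReal)).toENNReal

end

end DoobEntropy

end

/-!
The density `ρ₀(X(0)) e^{h(X(t))}` splits into a function of `X(0)` and the density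
`e^{h(X(t)) - V(t)h(X(0))}`. The first factor only changes the initial law of the Markov process
and accounts for `H(ℚ₀ | ℙ₀)`. The second factor is a Doob transform, which keeps the initial law
and whose relative entropy is `⟨h, γ(t)⟩ - ⟨V(t)h, γ(0)⟩`.

Under the Doob transform `X` is the Markov process with the time-dependent generator
`A^g f = e^{-g} (A (f e^g) - f A e^g)`, `g = V(t-s)h`, so that `⟨f, γ̇(s)⟩ = ⟨A^g f, γ(s)⟩`. By the
positive maximum principle `⟨A^g f, μ⟩ - ⟨Hf, μ⟩` is maximal at `f = g`. Since
`∂ₛ V(t-s)h = -H V(t-s)h`, the maximum `ℒ(γ(s), γ̇(s)) = ⟨A^g g - Hg, γ(s)⟩` is the derivative of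
`s ↦ ⟨V(t-s)h, γ(s)⟩`, and integration over `[0, t]` gives `⟨h, γ(t)⟩ - ⟨V(t)h, γ(0)⟩`.
-/

noncomputable section

namespace DoobEntropy

open CadlagPath CoreSpace FellerTransition InformationTheory

section RightDerivative

variable {F : Type*} [NormedAddCommGroup F] [NormedSpace ℝ F]

/-- The curve `u` has right derivative `u'` at time `s`. The difference quotient is written as in
the definition of the generator, so that `f ∈ 𝒟(A)` says that `r ↦ S(r) f` has a right derivative
at `0`. -/
def HasRightDeriv (u : ℝ≥0 → F) (u' : F) (s : ℝ≥0) : Prop :=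
  Tendsto (fun r : ℝ≥0 => (r : ℝ)⁻¹ • (u (s + r) - u s)) (𝓝[>] 0) (𝓝 u')

theorem map_coe_add_nhdsGT_zero (s : ℝ≥0) :
    map (fun r : ℝ≥0 => ((s + r : ℝ≥0) : ℝ)) (𝓝[>] 0) = 𝓝[>] (s : ℝ) := by
  have hcomp : (fun r : ℝ≥0 => ((s + r : ℝ≥0) : ℝ)) = Homeomorph.addLeft (s : ℝ) ∘ (↑) := by
    ext r
    simp
  rw [hcomp, ← map_map, NNReal.map_coe_nhdsGT,
    (Homeomorph.addLeft (s : ℝ)).isEmbedding.map_nhdsWithin_eq]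
  simp

theorem hasRightDeriv_iff_hasDerivWithinAt {u : ℝ≥0 → F} {u' : F} {s : ℝ≥0} :
    HasRightDeriv u u' s ↔
      HasDerivWithinAt (fun r : ℝ => u r.toNNReal) u' (Set.Ioi s) s := by
  rw [hasDerivWithinAt_iff_tendsto_slope' Set.self_notMem_Ioi, ← map_coe_add_nhdsGT_zero,
    tendsto_map'_iff]
  refine tendsto_congr fun r => ?_
  simp [slope]

namespace HasRightDeriv

variable {u v : ℝ≥0 → F} {u' v' : F} {s t : ℝ≥0}

theorem congr_of_Ico (hv : HasRightDeriv v v' s) (hst : s < t)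
    (h : ∀ r ∈ Set.Ico s t, u r = v r) : HasRightDeriv u v' s := by
  refine Tendsto.congr' ?_ hv
  filter_upwards [Ioo_mem_nhdsGT (tsub_pos_of_lt hst)] with r hr
  rw [h s ⟨le_rfl, hst⟩, h (s + r) ⟨le_self_add, lt_tsub_iff_left.1 hr.2⟩]

protected theorem const (c : F) : HasRightDeriv (fun _ => c) 0 s := by
  simp [HasRightDeriv]

theorem clm_apply {G : Type*} [NormedAddCommGroup G] [NormedSpace ℝ G] (L : F →L[ℝ] G)
    (hu : HasRightDeriv u u' s) : HasRightDeriv (fun r => L (u r)) (L u') s :=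
  ((L.continuous.tendsto u').comp hu).congr fun r => by simp

theorem mul {A : Type*} [NormedRing A] [NormedAlgebra ℝ A] {u v : ℝ≥0 → A} {u' v' : A}
    (hu : HasRightDeriv u u' s) (hv : HasRightDeriv v v' s) :
    HasRightDeriv (fun r => u r * v r) (u' * v s + u s * v') s := by
  rw [hasRightDeriv_iff_hasDerivWithinAt] at *
  simpa using hu.fun_mul hv

theorem integral_eq_sub [CompleteSpace F] {u u' : ℝ≥0 → F} (hu : Continuous u)
    (hderiv : ∀ s < t, HasRightDeriv u (u' s) s)
    (hint : IntegrableOn (fun s : ℝ => u' s.toNNReal) (Set.Icc 0 t)) :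
    ∫ s in Set.Icc (0 : ℝ) t, u' s.toNNReal = u t - u 0 := by
  rw [integral_Icc_eq_integral_Ioc, ← intervalIntegral.integral_of_le t.coe_nonneg]
  have hFTC := intervalIntegral.integral_eq_sub_of_hasDeriv_right_of_le t.coe_nonneg
    (hu.comp continuous_real_toNNReal).continuousOn (f' := fun s : ℝ => u' s.toNNReal) ?_
    ((intervalIntegrable_iff_integrableOn_Icc_of_le t.coe_nonneg).2 hint)
  · simpa using hFTC
  · intro s hs
    lift s to ℝ≥0 using hs.1.le
    rw [Real.toNNReal_coe]
    exact hasRightDeriv_iff_hasDerivWithinAt.1 (hderiv s (by exact_mod_cast hs.2))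

end HasRightDeriv

end RightDerivative

section Exponential

variable {E : Type*} [TopologicalSpace E]

@[simp] theorem expC_apply (f : C(E, ℝ)) (x : E) : expC f x = Real.exp (f x) := rfl

theorem expC_zero : expC (0 : C(E, ℝ)) = 1 := by
  ext x
  simp

theorem expC_add (f g : C(E, ℝ)) : expC (f + g) = expC f * expC g := by
  ext x
  simp [Real.exp_add]

theorem expC_neg_mul_expC (f : C(E, ℝ)) : expC (-f) * expC f = 1 := by
  rw [← expC_add, neg_add_cancel, expC_zero]

variable [CompactSpace E]

theorem expC_eq_exp (f : C(E, ℝ)) : expC f = NormedSpace.exp f := by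
  ext x
  have := NormedSpace.map_exp (ContinuousMap.evalAlgHom ℝ ℝ x) (continuous_eval_const x) f
  rw [expC_apply, Real.exp_eq_exp_ℝ]
  exact this.symm

theorem continuous_expC : Continuous (expC : C(E, ℝ) → C(E, ℝ)) := by
  rw [funext expC_eq_exp]
  exact NormedSpace.exp_continuous

/-- The exponential is differentiable in the Banach algebra `C(E)` with the invertible derivative
`k ↦ e^g k`, so a continuous logarithm of a differentiable curve is differentiable. -/
theorem HasRightDeriv.of_expC {g : ℝ≥0 → C(E, ℝ)} {k' : C(E, ℝ)} {s : ℝ≥0} (hg : Continuous g)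
    (hk : HasRightDeriv (fun r => expC (g r)) k' s) :
    HasRightDeriv g (expC (-g s) * k') s := by
  rw [hasRightDeriv_iff_hasDerivWithinAt, hasDerivWithinAt_Ioi_iff_Ici] at *
  have hexp (f : C(E, ℝ)) :
      HasFDerivWithinAt expC (ContinuousLinearMap.mul ℝ C(E, ℝ) (expC f)) Set.univ f := by
    rw [hasFDerivWithinAt_univ, funext expC_eq_exp]
    exact hasFDerivAt_exp
  have hinv (f : C(E, ℝ)) : Function.LeftInverse (ContinuousLinearMap.mul ℝ C(E, ℝ) (expC (-f)))
      (ContinuousLinearMap.mul ℝ C(E, ℝ) (expC f)) := fun k => by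
    simp [← mul_assoc, expC_neg_mul_expC]
  have hcont : Continuous fun r : ℝ => g r.toNNReal := hg.comp continuous_real_toNNReal
  have h := HasFDerivWithinAt.of_comp_of_leftInverse
    (hcont.continuousWithinAt.tendsto_nhdsWithin (Set.mapsTo_univ _ _)) (hexp _)
    hk.hasFDerivWithinAt EventuallyEq.rfl (hinv _) Set.self_mem_Ici
  simpa using h.hasDerivWithinAt

end Exponential

section Integral

variable {E : Type*} [TopologicalSpace E] [CompactSpace E] [MeasurableSpace E]

theorem norm_integral_le_norm (μ : Measure E) [IsProbabilityMeasure μ] (f : C(E, ℝ)) :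
    ‖∫ x, f x ∂μ‖ ≤ ‖f‖ := by
  simpa using norm_integral_le_of_norm_le_const (μ := μ)
    (Eventually.of_forall fun x => f.norm_coe_le_norm x)

variable [OpensMeasurableSpace E]

theorem integrable_continuousMap {μ : Measure E} [IsFiniteMeasure μ] (f : C(E, ℝ)) :
    Integrable f μ :=
  f.continuous.integrable_of_hasCompactSupport (HasCompactSupport.of_compactSpace _)

/-- Integration against a finite measure, as a continuous linear functional on `C(E)`. -/
def integralCLM (μ : Measure E) [IsFiniteMeasure μ] : C(E, ℝ) →L[ℝ] ℝ :=
  LinearMap.mkContinuous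
    { toFun := fun f => ∫ x, f x ∂μ
      map_add' := fun f g => integral_add (integrable_continuousMap f) (integrable_continuousMap g)
      map_smul' := fun c f => integral_const_mul c _ } (μ.real Set.univ) fun f => by
    rw [mul_comm]
    exact norm_integral_le_of_norm_le_const (Eventually.of_forall fun x => f.norm_coe_le_norm x)

@[simp] theorem integralCLM_apply (μ : Measure E) [IsFiniteMeasure μ] (f : C(E, ℝ)) :
    integralCLM μ f = ∫ x, f x ∂μ := rfl

theorem continuous_integral_probabilityMeasure :
    Continuous fun p : ProbabilityMeasure E × C(E, ℝ) => ∫ x, p.2 x ∂(p.1 : Measure E) := by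
  rw [continuous_iff_continuousAt]
  rintro ⟨μ, f⟩
  have hfix : Tendsto (fun p : ProbabilityMeasure E × C(E, ℝ) => ∫ x, f x ∂(p.1 : Measure E))
      (𝓝 (μ, f)) (𝓝 (∫ x, f x ∂(μ : Measure E))) :=
    (ProbabilityMeasure.tendsto_iff_forall_integral_tendsto.1 (continuous_fst.tendsto (μ, f))
      (BoundedContinuousFunction.mkOfCompact f))
  have hdiff : Tendsto (fun p : ProbabilityMeasure E × C(E, ℝ) =>
      ∫ x, (p.2 - f) x ∂(p.1 : Measure E)) (𝓝 (μ, f)) (𝓝 0) := by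
    refine squeeze_zero_norm (fun p => norm_integral_le_norm _ (p.2 - f)) ?_
    have hcont : Continuous fun p : ProbabilityMeasure E × C(E, ℝ) => ‖p.2 - f‖ := by fun_prop
    simpa using hcont.tendsto (μ, f)
  simpa only [ContinuousAt, add_zero, ← integralCLM_apply, ← map_add, add_sub_cancel] using
    hfix.add hdiff

end Integral

namespace FellerTransition

variable {E : Type*} [MetricSpace E] [CompactSpace E] [MeasurableSpace E] [BorelSpace E]
  (T : FellerTransition E)

section Semigroup

theorem S_apply (t : ℝ≥0) (f : C(E, ℝ)) (x : E) : T.S t f x = ∫ y, f y ∂(T.kernel t x) := rfl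

theorem S_add (t : ℝ≥0) (f g : C(E, ℝ)) : T.S t (f + g) = T.S t f + T.S t g := by
  have := T.isMarkov t
  ext x
  exact map_add (integralCLM (T.kernel t x)) f g

theorem S_smul (t : ℝ≥0) (c : ℝ) (f : C(E, ℝ)) : T.S t (c • f) = c • T.S t f := by
  have := T.isMarkov t
  ext x
  exact map_smul (integralCLM (T.kernel t x)) c f

theorem S_sub (t : ℝ≥0) (f g : C(E, ℝ)) : T.S t (f - g) = T.S t f - T.S t g := by
  have := T.isMarkov t
  ext x
  exact map_sub (integralCLM (T.kernel t x)) f g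

theorem S_one (t : ℝ≥0) : T.S t 1 = 1 := by
  have := T.isMarkov t
  ext x
  simp [S_apply]

theorem S_nonneg (t : ℝ≥0) {f : C(E, ℝ)} (hf : 0 ≤ f) : 0 ≤ T.S t f :=
  fun _ => integral_nonneg hf

theorem norm_S_le (t : ℝ≥0) (f : C(E, ℝ)) : ‖T.S t f‖ ≤ ‖f‖ := by
  have := T.isMarkov t
  exact (ContinuousMap.norm_le _ (norm_nonneg _)).2 fun x => norm_integral_le_norm _ f

theorem S_zero (f : C(E, ℝ)) : T.S 0 f = f := by
  ext x
  rw [S_apply, T.kernel_zero, Kernel.id_apply, integral_dirac]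

theorem S_comp (s t : ℝ≥0) (f : C(E, ℝ)) : T.S (s + t) f = T.S s (T.S t f) := by
  have := T.isMarkov s
  have := T.isMarkov t
  ext x
  rw [S_apply, T.kernel_add, Kernel.integral_comp (integrable_continuousMap f)]
  rfl

theorem continuous_S : Continuous fun p : ℝ≥0 × C(E, ℝ) => T.S p.1 p.2 := by
  rw [continuous_iff_continuousAt]
  rintro ⟨s, f⟩
  have hfix : Tendsto (fun p : ℝ≥0 × C(E, ℝ) => T.S p.1 f) (𝓝 (s, f)) (𝓝 (T.S s f)) :=
    ((T.strongly_continuous f).comp continuous_fst).tendsto (s, f)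
  have hdiff : Tendsto (fun p : ℝ≥0 × C(E, ℝ) => T.S p.1 (p.2 - f)) (𝓝 (s, f)) (𝓝 0) := by
    refine squeeze_zero_norm (fun p => T.norm_S_le p.1 (p.2 - f)) ?_
    have hcont : Continuous fun p : ℝ≥0 × C(E, ℝ) => ‖p.2 - f‖ := by fun_prop
    simpa using hcont.tendsto (s, f)
  simpa only [ContinuousAt, add_zero, ← S_add, add_sub_cancel] using hfix.add hdiff

variable {T} in
theorem continuous_S_apply {X : Type*} [TopologicalSpace X] {a : X → ℝ≥0}
    {u : X → C(E, ℝ)} (ha : Continuous a) (hu : Continuous u) :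
    Continuous fun x => T.S (a x) (u x) :=
  T.continuous_S.comp (ha.prodMk hu)

theorem expC_V (t : ℝ≥0) (f : C(E, ℝ)) : expC (T.V t f) = T.S t (expC f) := by
  ext x
  exact Real.exp_log (T.S_expC_pos t f x)

theorem V_zero (f : C(E, ℝ)) : T.V 0 f = f := by
  ext x
  change Real.log (T.S 0 (expC f) x) = f x
  rw [S_zero, expC_apply, Real.log_exp]

theorem continuous_V (f : C(E, ℝ)) : Continuous fun t => T.V t f := by
  refine ContinuousMap.continuous_of_continuous_uncurry _ ?_
  exact Continuous.log (f := fun p : ℝ≥0 × E => T.S p.1 (expC f) p.2)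
    (((T.strongly_continuous (expC f)).comp continuous_fst).eval continuous_snd)
    fun p => (T.S_expC_pos _ _ _).ne'

end Semigroup

section Generator

/-- `f` lies in the domain of the generator and `A f = f'`. -/
def HasGen (f f' : C(E, ℝ)) : Prop := Tendsto (T.quotient f) (𝓝[>] 0) (𝓝 f')

variable {T} {f g f' g' : C(E, ℝ)}

theorem hasGen_gen (hf : f ∈ T.genDomain) : T.HasGen f (T.gen f) :=
  tendsto_nhds_limUnder hf

namespace HasGen

theorem gen_eq (hf : T.HasGen f f') : T.gen f = f' :=
  tendsto_nhds_unique (hasGen_gen ⟨f', hf⟩) hf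

theorem add (hf : T.HasGen f f') (hg : T.HasGen g g') : T.HasGen (f + g) (f' + g') := by
  refine (Tendsto.add hf hg).congr fun t => ?_
  simp only [quotient, S_add]
  module

theorem const_smul (c : ℝ) (hf : T.HasGen f f') : T.HasGen (c • f) (c • f') := by
  refine (Tendsto.const_smul hf c).congr fun t => ?_
  simp only [quotient, S_smul]
  module

theorem semigroup (r : ℝ≥0) (hf : T.HasGen f f') : T.HasGen (T.S r f) (T.S r f') := by
  have hr : Continuous (T.S r) := continuous_S_apply continuous_const continuous_id
  refine ((hr.tendsto f').comp hf).congr fun t => ?_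
  simp only [Function.comp, quotient, S_smul, S_sub, ← S_comp, add_comm]

theorem positive_maximum_principle (hf : T.HasGen f f') (hnonneg : 0 ≤ f) {x : E} (hx : f x = 0) :
    0 ≤ f' x := by
  have hlim := ((continuous_eval_const (F := C(E, ℝ)) x).tendsto f').comp hf
  refine ge_of_tendsto' hlim fun t => ?_
  simpa [quotient, hx] using mul_nonneg (by positivity) (T.S_nonneg t hnonneg x)

end HasGen

theorem hasGen_one : T.HasGen 1 0 :=
  tendsto_const_nhds.congr fun t => by simp [quotient, S_one]

theorem gen_add (hf : f ∈ T.genDomain) (hg : g ∈ T.genDomain) :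
    T.gen (f + g) = T.gen f + T.gen g :=
  ((hasGen_gen hf).add (hasGen_gen hg)).gen_eq

theorem gen_smul (c : ℝ) (hf : f ∈ T.genDomain) : T.gen (c • f) = c • T.gen f :=
  ((hasGen_gen hf).const_smul c).gen_eq

theorem gen_S (r : ℝ≥0) (hf : f ∈ T.genDomain) : T.gen (T.S r f) = T.S r (T.gen f) :=
  ((hasGen_gen hf).semigroup r).gen_eq

end Generator

section Derivatives

variable {T} {s t : ℝ≥0}

theorem hasRightDeriv_S_apply {u : ℝ≥0 → C(E, ℝ)} {u' : C(E, ℝ)} {a : ℝ≥0}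
    (has : a ≤ s) (hu : HasRightDeriv u u' s) (hus : u s ∈ T.genDomain) :
    HasRightDeriv (fun r => T.S (r - a) (u r)) (T.S (s - a) (T.gen (u s) + u')) s := by
  have htime : Tendsto (fun r : ℝ≥0 => s + r - a) (𝓝[>] 0) (𝓝 (s - a)) := by
    have hcont : Continuous fun r : ℝ≥0 => s + r - a := by fun_prop
    simpa using (hcont.tendsto 0).mono_left nhdsWithin_le_nhds
  have hcurve := (T.continuous_S.tendsto (s - a, u')).comp (htime.prodMk_nhds hu)
  have horbit := (T.continuous_S.tendsto (s - a, T.gen (u s))).comp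
    (tendsto_const_nhds.prodMk_nhds (hasGen_gen hus))
  rw [S_add, add_comm]
  refine (hcurve.add horbit).congr fun r => ?_
  simp only [Function.comp, quotient, S_smul, S_sub, ← S_comp, ← tsub_add_eq_add_tsub has]
  module

theorem hasRightDeriv_S_sub {f : C(E, ℝ)} (hf : f ∈ T.genDomain) (hst : s < t) :
    HasRightDeriv (fun r => T.S (t - r) f) (-T.gen (T.S (t - s) f)) s := by
  have htime : Tendsto (fun r : ℝ≥0 => t - (s + r)) (𝓝[>] 0) (𝓝 (t - s)) := by
    have hcont : Continuous fun r : ℝ≥0 => t - (s + r) := by fun_prop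
    simpa using (hcont.tendsto 0).mono_left nhdsWithin_le_nhds
  rw [gen_S _ hf]
  refine ((T.continuous_S.tendsto (t - s, T.gen f)).comp
    (htime.prodMk_nhds (hasGen_gen hf))).neg.congr' ?_
  filter_upwards [Ioo_mem_nhdsGT (tsub_pos_of_lt hst)] with r hr
  have hsplit : t - (s + r) + r = t - s := by rw [← tsub_tsub, tsub_add_cancel_of_le hr.2.le]
  simp only [Function.comp, quotient, S_smul, S_sub, ← S_comp, hsplit]
  module

theorem hasRightDeriv_V_sub {h : C(E, ℝ)} (hh : expC h ∈ T.genDomain) (hst : s < t) :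
    HasRightDeriv (fun r => T.V (t - r) h) (-T.hamiltonian (T.V (t - s) h)) s := by
  have hk := hasRightDeriv_S_sub hh hst
  simp only [← expC_V] at hk
  have hcont : Continuous fun r => T.V (t - r) h := (T.continuous_V h).comp (by fun_prop)
  simpa [hamiltonian] using hk.of_expC hcont

end Derivatives

section TiltedGenerator

/-- The generator `A^g f = e^{-g} (A (f e^g) - f A e^g)` of the process transformed by `e^g`. -/
def tiltedGen (g f : C(E, ℝ)) : C(E, ℝ) :=
  expC (-g) * (T.gen (f * expC g) - f * T.gen (expC g))

variable {T} {f g : C(E, ℝ)}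

theorem expC_mul_tiltedGen (g f : C(E, ℝ)) :
    expC g * T.tiltedGen g f = T.gen (f * expC g) - f * T.gen (expC g) := by
  rw [tiltedGen, ← mul_assoc, mul_comm (expC g), expC_neg_mul_expC, one_mul]

theorem hamiltonian_zero : T.hamiltonian 0 = 0 := by
  rw [hamiltonian, expC_zero, hasGen_one.gen_eq, mul_zero]

theorem tiltedGen_zero_left (f : C(E, ℝ)) : T.tiltedGen 0 f = T.gen f := by
  simp [tiltedGen, expC_zero, hasGen_one.gen_eq]

/-- Apply the positive maximum principle at `x` to
`e^{g(x) - f(x)} e^f - (1 + (f - g) - (f(x) - g(x))) e^g`, which is nonnegative because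
`1 + a ≤ e^a` and vanishes at `x`. -/
theorem tiltedGen_sub_hamiltonian_le (hf : expC f ∈ T.genDomain) (hg : expC g ∈ T.genDomain)
    (hfg : f * expC g ∈ T.genDomain) (hgg : g * expC g ∈ T.genDomain) :
    T.tiltedGen g f - T.hamiltonian f ≤ T.tiltedGen g g - T.hamiltonian g := by
  intro x
  set φ : C(E, ℝ) := Real.exp (g x - f x) • expC f + (-1 : ℝ) • (f * expC g) + g * expC g
    + (f x - g x - 1) • expC g with hφ
  have hgen : T.HasGen φ (Real.exp (g x - f x) • T.gen (expC f) + (-1 : ℝ) • T.gen (f * expC g)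
      + T.gen (g * expC g) + (f x - g x - 1) • T.gen (expC g)) :=
    ((((hasGen_gen hf).const_smul _).add ((hasGen_gen hfg).const_smul _)).add
      (hasGen_gen hgg)).add ((hasGen_gen hg).const_smul _)
  have hφ_eq (y : E) : φ y = Real.exp (g y) *
      (Real.exp (f y - g y - (f x - g x)) - (f y - g y - (f x - g x) + 1)) := by
    have hexp : Real.exp (g x - f x) * Real.exp (f y)
        = Real.exp (g y) * Real.exp (f y - g y - (f x - g x)) := by
      rw [← Real.exp_add, ← Real.exp_add]
      ring_nf
    simp only [hφ, ContinuousMap.add_apply, ContinuousMap.smul_apply, ContinuousMap.mul_apply,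
      expC_apply, smul_eq_mul, hexp]
    ring
  have hnonneg : 0 ≤ φ := fun y => by
    change 0 ≤ φ y
    rw [hφ_eq]
    exact mul_nonneg (Real.exp_pos _).le (sub_nonneg.2 (Real.add_one_le_exp _))
  have hmax := hgen.positive_maximum_principle hnonneg (x := x) (by simp [hφ_eq])
  have hfactor : Real.exp (g x - f x) = Real.exp (g x) * Real.exp (-f x) := by
    rw [← Real.exp_add, sub_eq_add_neg]
  have hcancel : Real.exp (-g x) * Real.exp (g x) = 1 := by simp [← Real.exp_add]
  have hscaled := mul_nonneg (Real.exp_pos (-g x)).le hmax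
  simp only [ContinuousMap.add_apply, ContinuousMap.smul_apply, smul_eq_mul, hfactor] at hscaled
  change (T.tiltedGen g f - T.hamiltonian f) x ≤ (T.tiltedGen g g - T.hamiltonian g) x
  simp only [tiltedGen, hamiltonian, ContinuousMap.sub_apply, ContinuousMap.mul_apply, expC_apply,
    ContinuousMap.neg_apply]
  linear_combination hscaled + Real.exp (-f x) * T.gen (expC f) x * hcancel

end TiltedGenerator

end FellerTransition

section LiftsContinuously

variable {E : Type*} [TopologicalSpace E] {D : Submodule ℝ C(E, ℝ)}

namespace CoreSpace

theorem incl_mem (f : CoreSpace D) : incl D f ∈ D := Subtype.property (p := (· ∈ D)) f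

theorem exists_incl_eq {f : C(E, ℝ)} (hf : f ∈ D) : ∃ f' : CoreSpace D, incl D f' = f :=
  ⟨(⟨f, hf⟩ : D), rfl⟩

variable (D) [TopologicalSpace (CoreSpace D)] {X : Type*} [TopologicalSpace X]

/-- The map `c` takes its values in `D` and is continuous for the topology `τ_D`. -/
def LiftsContinuously (c : X → C(E, ℝ)) : Prop :=
  ∃ c' : X → CoreSpace D, (∀ x, incl D (c' x) = c x) ∧ Continuous c'

variable {D}

theorem liftsContinuously_incl : LiftsContinuously D fun f : CoreSpace D => incl D f :=
  ⟨id, fun _ => rfl, continuous_id⟩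

theorem liftsContinuously_const {f : C(E, ℝ)} (hf : f ∈ D) :
    LiftsContinuously D fun _ : X => f :=
  have ⟨f', hf'⟩ := exists_incl_eq hf
  ⟨fun _ => f', fun _ => hf', continuous_const⟩

namespace LiftsContinuously

variable {c : X → C(E, ℝ)}

theorem mem (hc : LiftsContinuously D c) (x : X) : c x ∈ D := by
  obtain ⟨c', hc', -⟩ := hc
  exact hc' x ▸ incl_mem _

theorem comp {Y : Type*} [TopologicalSpace Y] {a : Y → X} (hc : LiftsContinuously D c)
    (ha : Continuous a) : LiftsContinuously D fun y => c (a y) :=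
  have ⟨c', hc', hcont⟩ := hc
  ⟨fun y => c' (a y), fun y => hc' (a y), hcont.comp ha⟩

theorem continuous_comp {Y : Type*} [TopologicalSpace Y] {Φ : C(E, ℝ) → Y}
    (hΦ : Continuous fun f : CoreSpace D => Φ (incl D f)) (hc : LiftsContinuously D c) :
    Continuous fun x => Φ (c x) := by
  obtain ⟨c', hc', hcont⟩ := hc
  simpa only [Function.comp_def, hc'] using hΦ.comp hcont

end LiftsContinuously

end CoreSpace

end LiftsContinuously

section TopologicalDomain

variable {E : Type*} [MetricSpace E] [CompactSpace E] [MeasurableSpace E] [BorelSpace E]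
  {T : FellerTransition E} {D : Submodule ℝ C(E, ℝ)} [TopologicalSpace (CoreSpace D)]

variable (T D) in
/-- The part of the conditions on `(D, τ_D)` that makes the time-dependent Doob transform
differentiable: `D` is contained in `𝒟(A)` and is closed under exponentials, products and `V(t)`,
the topology `τ_D` is finer than the sup norm, and the operations on `D`, the orbits of `V` and
`A : D → C(E)` are continuous for it. -/
structure IsTopologicalDomain : Prop where
  subset_domain : ∀ f ∈ D, f ∈ T.genDomain
  continuous_incl : Continuous (incl D)
  exp : LiftsContinuously D fun f : CoreSpace D => expC (incl D f)
  mul : LiftsContinuously D fun p : CoreSpace D × CoreSpace D => incl D p.1 * incl D p.2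
  V : ∀ f ∈ D, LiftsContinuously D fun t => T.V t f
  continuous_gen : Continuous fun f : CoreSpace D => T.gen (incl D f)

theorem IsTopologicalCore.isTopologicalDomain (hD : IsTopologicalCore T D) :
    IsTopologicalDomain T D where
  subset_domain := hD.subset_domain
  continuous_incl := hD.finer
  exp := by
    have := hD.topologicalAddGroup
    obtain ⟨one, hone⟩ := exists_incl_eq (hD.comp_mem 0 D.zero_mem (fun _ => 1) contDiff_const)
    obtain ⟨e, he, hcont⟩ := hD.exp_continuous
    refine ⟨fun f => e f + one, fun f => ?_, hcont.add continuous_const⟩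
    rw [map_add, he, hone]
    exact sub_add_cancel _ _
  mul := by
    obtain ⟨m, hm, hcont⟩ := hD.mul_continuous
    exact ⟨m, fun p => hm p.1 p.2, hcont⟩
  V f hf := by
    obtain ⟨v, hv, -, hcont⟩ := hD.V_restricts
    obtain ⟨f', rfl⟩ := exists_incl_eq hf
    exact ⟨fun t => v t f', fun t => hv t f', hcont f'⟩
  continuous_gen := hD.gen_continuous

namespace IsTopologicalDomain

variable {X : Type*} [TopologicalSpace X] {f g : X → C(E, ℝ)}

theorem liftsContinuously_expC (hD : IsTopologicalDomain T D) (hf : LiftsContinuously D f) :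
    LiftsContinuously D fun x => expC (f x) := by
  obtain ⟨f', hf', hcont⟩ := hf
  simpa only [hf'] using hD.exp.comp hcont

theorem liftsContinuously_mul (hD : IsTopologicalDomain T D) (hf : LiftsContinuously D f)
    (hg : LiftsContinuously D g) : LiftsContinuously D fun x => f x * g x := by
  obtain ⟨f', hf', hfcont⟩ := hf
  obtain ⟨g', hg', hgcont⟩ := hg
  simpa only [hf', hg'] using hD.mul.comp (hfcont.prodMk hgcont)

theorem expC_mem (hD : IsTopologicalDomain T D) {f : C(E, ℝ)} (hf : f ∈ D) : expC f ∈ D :=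
  (hD.liftsContinuously_expC (liftsContinuously_const (X := Unit) hf)).mem ()

theorem mul_mem (hD : IsTopologicalDomain T D) {f g : C(E, ℝ)} (hf : f ∈ D) (hg : g ∈ D) :
    f * g ∈ D :=
  (hD.liftsContinuously_mul (X := Unit) (liftsContinuously_const hf)
    (liftsContinuously_const hg)).mem ()

theorem mul_expC_mem_genDomain (hD : IsTopologicalDomain T D) {f g : C(E, ℝ)} (hf : f ∈ D)
    (hg : g ∈ D) : f * expC g ∈ T.genDomain :=
  hD.subset_domain _ (hD.mul_mem hf (hD.expC_mem hg))

theorem expC_mem_genDomain (hD : IsTopologicalDomain T D) {f : C(E, ℝ)} (hf : f ∈ D) :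
    expC f ∈ T.genDomain :=
  hD.subset_domain _ (hD.expC_mem hf)

theorem continuous_hamiltonian (hD : IsTopologicalDomain T D) (hf : LiftsContinuously D f) :
    Continuous fun x => T.hamiltonian (f x) := by
  have hcont : Continuous f := hf.continuous_comp (Φ := id) hD.continuous_incl
  exact (continuous_expC.comp hcont.neg).mul
    ((hD.liftsContinuously_expC hf).continuous_comp hD.continuous_gen)

theorem continuous_tiltedGen (hD : IsTopologicalDomain T D) (hg : LiftsContinuously D g)
    (hf : LiftsContinuously D f) : Continuous fun x => T.tiltedGen (g x) (f x) := by
  have hfcont : Continuous f := hf.continuous_comp (Φ := id) hD.continuous_incl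
  have hgcont : Continuous g := hg.continuous_comp (Φ := id) hD.continuous_incl
  have hexp := hD.liftsContinuously_expC hg
  exact (continuous_expC.comp hgcont.neg).mul
    (((hD.liftsContinuously_mul hf hexp).continuous_comp hD.continuous_gen).sub
      (hfcont.mul (hexp.continuous_comp hD.continuous_gen)))

/-- The tilted generator `A^g` as a continuous linear operator from `(D, τ_D)` to `C(E)`. -/
def tiltedGenCLM (hD : IsTopologicalDomain T D) {g : C(E, ℝ)} (hg : g ∈ D) :
    CoreSpace D →L[ℝ] C(E, ℝ) where
  toFun f := T.tiltedGen g (incl D f)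
  map_add' f₁ f₂ := by
    simp only [FellerTransition.tiltedGen, map_add, add_mul,
      FellerTransition.gen_add (hD.mul_expC_mem_genDomain (incl_mem f₁) hg)
        (hD.mul_expC_mem_genDomain (incl_mem f₂) hg)]
    ring
  map_smul' c f := by
    simp only [FellerTransition.tiltedGen, map_smul, smul_mul_assoc, mul_smul_comm, ← smul_sub,
      FellerTransition.gen_smul c (hD.mul_expC_mem_genDomain (incl_mem f) hg), RingHom.id_apply]
  cont := hD.continuous_tiltedGen (liftsContinuously_const hg) liftsContinuously_incl

theorem lagrangian_tiltedGen (hD : IsTopologicalDomain T D) {g : C(E, ℝ)} (hg : g ∈ D)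
    (μ : ProbabilityMeasure E) :
    lagrangian T μ ((integralCLM (μ : Measure E)).comp (hD.tiltedGenCLM hg)) =
      ((∫ x, (T.tiltedGen g g - T.hamiltonian g) x ∂(μ : Measure E) : ℝ) : EReal) := by
  have hvalue (f : CoreSpace D) :
      (integralCLM (μ : Measure E)).comp (hD.tiltedGenCLM hg) f
        - ∫ x, T.hamiltonian (incl D f) x ∂(μ : Measure E)
      = integralCLM (μ : Measure E) (T.tiltedGen g (incl D f) - T.hamiltonian (incl D f)) := by
    rw [map_sub]
    rfl
  simp only [lagrangian, hvalue]
  refine le_antisymm (iSup_le fun f => EReal.coe_le_coe ?_) ?_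
  · exact integral_mono (integrable_continuousMap _) (integrable_continuousMap _)
      (FellerTransition.tiltedGen_sub_hamiltonian_le (hD.expC_mem_genDomain (incl_mem f))
        (hD.expC_mem_genDomain hg) (hD.mul_expC_mem_genDomain (incl_mem f) hg)
        (hD.mul_expC_mem_genDomain hg hg))
  · obtain ⟨g', rfl⟩ := exists_incl_eq hg
    exact le_iSup (fun f : CoreSpace D => ((integralCLM (μ : Measure E)
      (T.tiltedGen (incl D g') (incl D f) - T.hamiltonian (incl D f)) : ℝ) : EReal)) g'

end IsTopologicalDomain

end TopologicalDomain

section Uniqueness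

theorem ae_eq_zero_of_setIntegral_Icc_eq_zero {F : Type*} [NormedAddCommGroup F] [NormedSpace ℝ F]
    [CompleteSpace F] {f : ℝ → F} {a b : ℝ} (hf : IntegrableOn f (Set.Icc a b))
    (hzero : ∀ x ∈ Set.Icc a b, ∫ s in Set.Icc a x, f s = 0) :
    f =ᵐ[volume.restrict (Set.Icc a b)] 0 := by
  rcases lt_or_ge b a with hba | hab
  · simp [Set.Icc_eq_empty_of_lt hba, EventuallyEq]
  have hderiv := ((intervalIntegrable_iff_integrableOn_Icc_of_le hab).2 hf).ae_hasDerivAt_integral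
  rw [Set.uIcc_of_le hab] at hderiv
  rw [← restrict_Ioo_eq_restrict_Icc, EventuallyEq, ae_restrict_iff' measurableSet_Ioo]
  filter_upwards [hderiv] with s hs hmem
  refine (hs (Set.Ioo_subset_Icc_self hmem) a (Set.left_mem_Icc.2 hab)).unique ?_
  refine (hasDerivAt_const s (0 : F)).congr_of_eventuallyEq ?_
  filter_upwards [Ioo_mem_nhds hmem.1 hmem.2] with x hx
  rw [intervalIntegral.integral_of_le hx.1.le, ← integral_Icc_eq_integral_Ioc,
    hzero x (Set.Ioo_subset_Icc_self hx)]

variable {E : Type*} [MetricSpace E] [MeasurableSpace E]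
  {D : Submodule ℝ C(E, ℝ)} [TopologicalSpace (CoreSpace D)]
  {u v : ℝ≥0 → CoreSpace D →L[ℝ] ℝ} {ν : ℝ≥0 → ProbabilityMeasure E}

namespace IsDerivativeOf

theorem integrableOn (hu : IsDerivativeOf u ν) (f : CoreSpace D) (r : ℝ≥0) :
    IntegrableOn (fun s : ℝ => u s.toNNReal f) (Set.Icc 0 (r : ℝ)) :=
  ⟨((hu.measurable f).mono_measure
    (Measure.restrict_mono Set.Icc_subset_Ici_self le_rfl)).aestronglyMeasurable,
    hu.integrable f r⟩

theorem ae_eq [TopologicalSpace.SeparableSpace (CoreSpace D)] (hu : IsDerivativeOf u ν)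
    (hv : IsDerivativeOf v ν) (t : ℝ≥0) :
    ∀ᵐ s : ℝ ∂volume.restrict (Set.Icc 0 (t : ℝ)), u s.toNNReal = v s.toNNReal := by
  have heval (f : CoreSpace D) : ∀ᵐ s : ℝ ∂volume.restrict (Set.Icc 0 (t : ℝ)),
      u s.toNNReal f = v s.toNNReal f := by
    have hdiff := ae_eq_zero_of_setIntegral_Icc_eq_zero
      ((hu.integrableOn f t).sub (hv.integrableOn f t)) fun x hx => by
        lift x to ℝ≥0 using hx.1
        simp only [Pi.sub_apply]
        rw [integral_sub (hu.integrableOn f x) (hv.integrableOn f x), ← hu.integral_eq,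
          ← hv.integral_eq, sub_self]
    exact hdiff.mono fun s hs => sub_eq_zero.1 hs
  filter_upwards [ae_all_iff.2 fun n => heval (TopologicalSpace.denseSeq (CoreSpace D) n)]
    with s hs
  exact DFunLike.coe_injective ((u _).continuous.ext_on
    (TopologicalSpace.denseRange_denseSeq _) (v _).continuous (Set.forall_mem_range.2 hs))

end IsDerivativeOf

end Uniqueness

section DoobCurve

variable {E : Type*} [MetricSpace E] [CompactSpace E] [MeasurableSpace E] [BorelSpace E]

/-- `γ` is the curve of one-dimensional laws of the Doob transform of the Markov process by the
weight `e^{h(X(t))}`. Writing `g(s) = V(t - s) h`, this says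
`⟨F, γ(s)⟩ = ⟨e^{-g(0)} S(s)(e^{g(s)} F), γ(0)⟩` for `s ≤ t`, and that `γ` evolves freely after `t`;
the truncated subtractions `s - t` and `t - s` allow both cases to be stated at once. -/
def IsDoobCurve (T : FellerTransition E) (h : C(E, ℝ)) (t : ℝ≥0)
    (γ : ℝ≥0 → ProbabilityMeasure E) : Prop :=
  ∀ (s : ℝ≥0) (F : C(E, ℝ)), ∫ x, F x ∂(γ s : Measure E) =
    ∫ x, (expC (-T.V t h) * T.S (min s t) (T.S (s - t) F * expC (T.V (t - s) h))) x
      ∂(γ 0 : Measure E)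

namespace IsDoobCurve

variable {T : FellerTransition E} {h : C(E, ℝ)} {s t : ℝ≥0} {γ : ℝ≥0 → ProbabilityMeasure E}

theorem integral_of_le (hγ : IsDoobCurve T h t γ) (hst : s ≤ t) (F : C(E, ℝ)) :
    ∫ x, F x ∂(γ s : Measure E) =
      ∫ x, (expC (-T.V t h) * T.S s (F * expC (T.V (t - s) h))) x ∂(γ 0 : Measure E) := by
  rw [hγ, min_eq_left hst, tsub_eq_zero_of_le hst, S_zero]

theorem integral_of_ge (hγ : IsDoobCurve T h t γ) (hts : t ≤ s) (F : C(E, ℝ)) :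
    ∫ x, F x ∂(γ s : Measure E) = ∫ x, T.S (s - t) F x ∂(γ t : Measure E) := by
  rw [hγ, hγ.integral_of_le le_rfl, min_eq_right hts, tsub_eq_zero_of_le hts, tsub_self]

protected theorem continuous (hγ : IsDoobCurve T h t γ) : Continuous γ := by
  refine continuous_iff_continuousAt.2 fun s =>
    ProbabilityMeasure.tendsto_iff_forall_integral_tendsto.2 fun F => ?_
  suffices Continuous fun s => ∫ x, F.toContinuousMap x ∂(γ s : Measure E) from this.tendsto s
  simp only [hγ _ F.toContinuousMap, expC_V]
  have hcurve : Continuous fun s => T.S (min s t)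
      (T.S (s - t) F.toContinuousMap * T.S (t - s) (expC h)) :=
    continuous_S_apply (by fun_prop)
      ((continuous_S_apply (by fun_prop) continuous_const).mul
        (continuous_S_apply (by fun_prop) continuous_const))
  exact (integralCLM (γ 0 : Measure E)).continuous.comp (hcurve.const_mul _)

theorem continuous_integral (hγ : IsDoobCurve T h t γ) {w : ℝ≥0 → C(E, ℝ)} (hw : Continuous w) :
    Continuous fun s => ∫ x, w s x ∂(γ s : Measure E) :=
  continuous_integral_probabilityMeasure.comp (hγ.continuous.prodMk hw)

theorem hasRightDeriv_integral_of_lt (hγ : IsDoobCurve T h t γ) (hst : s < t)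
    (hh : expC h ∈ T.genDomain) {w : ℝ≥0 → C(E, ℝ)} {w' : C(E, ℝ)} (hw : HasRightDeriv w w' s)
    (hws : w s * expC (T.V (t - s) h) ∈ T.genDomain) :
    HasRightDeriv (fun r => ∫ x, w r x ∂(γ r : Measure E))
      (∫ x, (T.tiltedGen (T.V (t - s) h) (w s) + w') x ∂(γ s : Measure E)) s := by
  have hweight : HasRightDeriv (fun r => expC (T.V (t - r) h))
      (-T.gen (expC (T.V (t - s) h))) s := by
    simpa only [expC_V] using hasRightDeriv_S_sub hh hst
  have hcurve := hasRightDeriv_S_apply zero_le (hw.mul hweight) hws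
  have hgen : T.gen (w s * expC (T.V (t - s) h)) + (w' * expC (T.V (t - s) h)
      + w s * -T.gen (expC (T.V (t - s) h)))
      = (T.tiltedGen (T.V (t - s) h) (w s) + w') * expC (T.V (t - s) h) := by
    linear_combination -expC_mul_tiltedGen (T := T) (T.V (t - s) h) (w s)
  have hderiv := hcurve.clm_apply ((integralCLM (γ 0 : Measure E)).comp
    (ContinuousLinearMap.mul ℝ _ (expC (-T.V t h))))
  simp only [hgen, tsub_zero] at hderiv
  rw [hγ.integral_of_le hst.le]
  exact hderiv.congr_of_Ico hst fun r hr => hγ.integral_of_le hr.2.le (w r)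

theorem hasRightDeriv_integral_of_ge (hγ : IsDoobCurve T h t γ) (hts : t ≤ s) {f : C(E, ℝ)}
    (hf : f ∈ T.genDomain) :
    HasRightDeriv (fun r => ∫ x, f x ∂(γ r : Measure E))
      (∫ x, T.gen f x ∂(γ s : Measure E)) s := by
  have hcurve := hasRightDeriv_S_apply hts (HasRightDeriv.const f) hf
  rw [add_zero] at hcurve
  rw [hγ.integral_of_ge hts]
  exact (hcurve.clm_apply (integralCLM (γ t : Measure E))).congr_of_Ico (lt_add_one s)
    fun r hr => hγ.integral_of_ge (hts.trans hr.1) f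

end IsDoobCurve

end DoobCurve

section Velocity

variable {E : Type*} [MetricSpace E] [CompactSpace E] [MeasurableSpace E] [BorelSpace E]
  {T : FellerTransition E} {D : Submodule ℝ C(E, ℝ)} [TopologicalSpace (CoreSpace D)]
  {h : C(E, ℝ)} {s t : ℝ≥0} {γ : ℝ≥0 → ProbabilityMeasure E}

/-- The logarithm of the space-time harmonic function of the Doob transform: the transformed
process has generator `A^g` at time `s` with `g = doobPotential T h t s`. -/
def doobPotential (T : FellerTransition E) (h : C(E, ℝ)) (t s : ℝ≥0) : C(E, ℝ) :=
  if s < t then T.V (t - s) h else 0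

namespace IsTopologicalDomain

theorem doobPotential_mem (hD : IsTopologicalDomain T D) (hh : h ∈ D) :
    doobPotential T h t s ∈ D := by
  unfold doobPotential
  split_ifs
  exacts [(hD.V h hh).mem _, D.zero_mem]

/-- The velocity `f ↦ ⟨A^{g(s)} f, γ(s)⟩` of the curve `γ`, with `g(s)` the Doob potential. -/
def doobVelocity (hD : IsTopologicalDomain T D) (hh : h ∈ D) (t : ℝ≥0)
    (γ : ℝ≥0 → ProbabilityMeasure E) (s : ℝ≥0) : CoreSpace D →L[ℝ] ℝ :=
  (integralCLM (γ s : Measure E)).comp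
    (hD.tiltedGenCLM (hD.doobPotential_mem (t := t) (s := s) hh))

theorem doobVelocity_apply (hD : IsTopologicalDomain T D) (hh : h ∈ D) (f : CoreSpace D) :
    hD.doobVelocity hh t γ s f = if s < t
      then ∫ x, T.tiltedGen (T.V (t - s) h) (incl D f) x ∂(γ s : Measure E)
      else ∫ x, T.gen (incl D f) x ∂(γ s : Measure E) := by
  change ∫ x, T.tiltedGen (doobPotential T h t s) (incl D f) x ∂(γ s : Measure E) = _
  unfold doobPotential
  split_ifs
  exacts [rfl, by rw [tiltedGen_zero_left]]

end IsTopologicalDomain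

namespace IsDoobCurve

theorem hasRightDeriv_integral (hγ : IsDoobCurve T h t γ) (hD : IsTopologicalDomain T D)
    (hh : h ∈ D) (f : CoreSpace D) (s : ℝ≥0) :
    HasRightDeriv (fun r => ∫ x, incl D f x ∂(γ r : Measure E)) (hD.doobVelocity hh t γ s f) s := by
  rw [hD.doobVelocity_apply]
  split_ifs with hst
  · simpa using hγ.hasRightDeriv_integral_of_lt hst (hD.expC_mem_genDomain hh)
      (HasRightDeriv.const (incl D f))
      (hD.mul_expC_mem_genDomain (incl_mem f) ((hD.V h hh).mem (t - s)))
  · exact hγ.hasRightDeriv_integral_of_ge (not_lt.1 hst) (hD.subset_domain _ (incl_mem f))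

theorem measurable_and_integrableOn_doobVelocity (hγ : IsDoobCurve T h t γ)
    (hD : IsTopologicalDomain T D) (hh : h ∈ D) (f : CoreSpace D) :
    Measurable (fun s : ℝ => hD.doobVelocity hh t γ s.toNNReal f) ∧
      ∀ r : ℝ, IntegrableOn (fun s : ℝ => hD.doobVelocity hh t γ s.toNNReal f) (Set.Icc 0 r) := by
  simp only [hD.doobVelocity_apply]
  have hbefore : Continuous fun s : ℝ =>
      ∫ x, T.tiltedGen (T.V (t - s.toNNReal) h) (incl D f) x ∂(γ s.toNNReal : Measure E) :=
    (hγ.continuous_integral (hD.continuous_tiltedGen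
      ((hD.V h hh).comp (by fun_prop : Continuous fun s => t - s))
      (liftsContinuously_const (incl_mem f)))).comp continuous_real_toNNReal
  have hafter : Continuous fun s : ℝ => ∫ x, T.gen (incl D f) x ∂(γ s.toNNReal : Measure E) :=
    (hγ.continuous_integral continuous_const).comp continuous_real_toNNReal
  have hset : MeasurableSet {s : ℝ | s.toNNReal < t} :=
    measurableSet_lt measurable_real_toNNReal measurable_const
  exact ⟨hbefore.measurable.ite hset hafter.measurable, fun r =>
    Integrable.piecewise (s := {s : ℝ | s.toNNReal < t}) hset hbefore.integrableOn_Icc.integrableOn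
      hafter.integrableOn_Icc.integrableOn⟩

theorem isDerivativeOf_doobVelocity (hγ : IsDoobCurve T h t γ) (hD : IsTopologicalDomain T D)
    (hh : h ∈ D) : IsDerivativeOf (hD.doobVelocity hh t γ) γ where
  measurable f := (hγ.measurable_and_integrableOn_doobVelocity hD hh f).1.aemeasurable
  integrable f r := ((hγ.measurable_and_integrableOn_doobVelocity hD hh f).2 r).2
  integral_eq f r := (HasRightDeriv.integral_eq_sub (hγ.continuous_integral continuous_const)
    (fun s _ => hγ.hasRightDeriv_integral hD hh f s)
    ((hγ.measurable_and_integrableOn_doobVelocity hD hh f).2 r)).symm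

theorem isAbsolutelyContinuousCurve (hγ : IsDoobCurve T h t γ) (hD : IsTopologicalDomain T D)
    (hh : h ∈ D) : IsAbsolutelyContinuousCurve D γ :=
  ⟨hγ.continuous, _, hγ.isDerivativeOf_doobVelocity hD hh⟩

end IsDoobCurve

end Velocity

section Cost

variable {E : Type*} [MetricSpace E] [CompactSpace E] [MeasurableSpace E] [BorelSpace E]
  {T : FellerTransition E} {D : Submodule ℝ C(E, ℝ)} [TopologicalSpace (CoreSpace D)]
  {h : C(E, ℝ)} {s t : ℝ≥0} {γ : ℝ≥0 → ProbabilityMeasure E}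

theorem lagrangian_nonneg (T : FellerTransition E) (μ : ProbabilityMeasure E)
    (u : CoreSpace D →L[ℝ] ℝ) : 0 ≤ lagrangian T μ u :=
  le_iSup_of_le 0 (by simp [hamiltonian_zero])

/-- The value of the Lagrangian at time `s` along a Doob curve, attained in its defining supremum
at `g = V(t - s) h`. -/
def doobLagrangian (T : FellerTransition E) (h : C(E, ℝ)) (t : ℝ≥0)
    (γ : ℝ≥0 → ProbabilityMeasure E) (s : ℝ≥0) : ℝ :=
  ∫ x, (T.tiltedGen (T.V (t - s) h) (T.V (t - s) h) - T.hamiltonian (T.V (t - s) h)) x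
    ∂(γ s : Measure E)

theorem IsTopologicalDomain.lagrangian_doobVelocity (hD : IsTopologicalDomain T D) (hh : h ∈ D)
    (hst : s < t) : lagrangian T (γ s) (hD.doobVelocity hh t γ s) = doobLagrangian T h t γ s := by
  have hpotential : doobPotential T h t s = T.V (t - s) h := if_pos hst
  unfold IsTopologicalDomain.doobVelocity
  rw [hD.lagrangian_tiltedGen, hpotential, doobLagrangian]

namespace IsDoobCurve

theorem integrableOn_doobLagrangian (hγ : IsDoobCurve T h t γ) (hD : IsTopologicalDomain T D)
    (hh : h ∈ D) :
    IntegrableOn (fun s : ℝ => doobLagrangian T h t γ s.toNNReal) (Set.Icc 0 t) := by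
  have hpotential : LiftsContinuously D fun s => T.V (t - s) h := (hD.V h hh).comp (by fun_prop)
  have hcont : Continuous (doobLagrangian T h t γ) := hγ.continuous_integral
    ((hD.continuous_tiltedGen hpotential hpotential).sub (hD.continuous_hamiltonian hpotential))
  exact (hcont.comp continuous_real_toNNReal).integrableOn_Icc

/-- The potential `g(s) = V(t - s) h` solves `∂ₛ g + H g = 0`, so that
`d/ds ⟨g(s), γ(s)⟩ = ⟨A^g g - H g, γ(s)⟩`. -/
theorem integral_doobLagrangian (hγ : IsDoobCurve T h t γ) (hD : IsTopologicalDomain T D)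
    (hh : h ∈ D) : ∫ s in Set.Icc (0 : ℝ) t, doobLagrangian T h t γ s.toNNReal =
      ∫ x, h x ∂(γ t : Measure E) - ∫ x, T.V t h x ∂(γ 0 : Measure E) := by
  have hpotential : Continuous fun s => T.V (t - s) h := (T.continuous_V h).comp (by fun_prop)
  have hexp := hD.expC_mem_genDomain hh
  rw [HasRightDeriv.integral_eq_sub (hγ.continuous_integral hpotential) (fun s hst => ?_)
    (hγ.integrableOn_doobLagrangian hD hh)]
  · simp only [tsub_self, tsub_zero, V_zero]
  · have hmem := (hD.V h hh).mem (t - s)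
    simpa only [doobLagrangian, sub_eq_add_neg] using hγ.hasRightDeriv_integral_of_lt hst hexp
      (hasRightDeriv_V_sub hexp hst) (hD.mul_expC_mem_genDomain hmem hmem)

theorem lagrangianCost_eq [TopologicalSpace.SeparableSpace (CoreSpace D)]
    (hγ : IsDoobCurve T h t γ) (hD : IsTopologicalDomain T D) (hh : h ∈ D)
    {u : ℝ≥0 → CoreSpace D →L[ℝ] ℝ} (hu : IsDerivativeOf u γ) :
    lagrangianCost T γ u t = ENNReal.ofReal
      (∫ x, h x ∂(γ t : Measure E) - ∫ x, T.V t h x ∂(γ 0 : Measure E)) := by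
  have hlagrangian : ∀ᵐ s : ℝ ∂volume.restrict (Set.Icc 0 (t : ℝ)),
      lagrangian T (γ s.toNNReal) (u s.toNNReal) = doobLagrangian T h t γ s.toNNReal := by
    have hne : ∀ᵐ s : ℝ ∂volume.restrict (Set.Icc 0 (t : ℝ)), s ≠ t :=
      ae_restrict_of_ae (Measure.ae_ne volume (t : ℝ))
    filter_upwards [hu.ae_eq (hγ.isDerivativeOf_doobVelocity hD hh) t, hne,
      ae_restrict_mem measurableSet_Icc] with s hs hst hmem
    rw [hs, hD.lagrangian_doobVelocity hh
      ((Real.toNNReal_lt_iff_lt_coe hmem.1).2 (hmem.2.lt_of_ne hst))]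
  have hnonneg : 0 ≤ᵐ[volume.restrict (Set.Icc 0 (t : ℝ))]
      fun s => doobLagrangian T h t γ s.toNNReal := by
    filter_upwards [hlagrangian] with s hs
    exact EReal.coe_nonneg.1 (hs ▸ lagrangian_nonneg T _ (u s.toNNReal))
  rw [← hγ.integral_doobLagrangian hD hh, ofReal_integral_eq_lintegral_ofReal
    (hγ.integrableOn_doobLagrangian hD hh) hnonneg]
  refine lintegral_congr_ae ?_
  filter_upwards [hlagrangian] with s hs
  rw [hs, EReal.real_coe_toENNReal]

end IsDoobCurve

end Cost

section Densities

theorem condExp_withDensity {α : Type*} {m m₀ : MeasurableSpace α} (hm : m ≤ m₀) {μ : Measure α}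
    [SigmaFinite (μ.trim hm)] {d : α → ℝ≥0} (hd : Measurable[m] d)
    [SigmaFinite ((μ.withDensity fun x => (d x : ℝ≥0∞)).trim hm)] {f : α → ℝ}
    (hf : Integrable f μ) (hfd : Integrable f (μ.withDensity fun x => (d x : ℝ≥0∞))) :
    (μ.withDensity fun x => (d x : ℝ≥0∞))[f|m]
      =ᵐ[μ.withDensity fun x => (d x : ℝ≥0∞)] μ[f|m] := by
  have hd₀ : Measurable d := hd.mono hm le_rfl
  have hdf : Integrable (fun x => d x • f x) μ :=
    (integrable_withDensity_iff_integrable_smul hd₀).1 hfd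
  have hpull : μ[fun x => d x • f x|m] =ᵐ[μ] fun x => d x • μ[f|m] x :=
    condExp_mul_of_stronglyMeasurable_left hd.coe_nnreal_real.stronglyMeasurable hdf hf
  have hint : Integrable (μ[f|m]) (μ.withDensity fun x => (d x : ℝ≥0∞)) :=
    (integrable_withDensity_iff_integrable_smul hd₀).2 (integrable_condExp.congr hpull)
  refine (ae_eq_condExp_of_forall_setIntegral_eq hm hfd (fun _ _ _ => hint.integrableOn)
    (fun A hA _ => ?_) stronglyMeasurable_condExp.aestronglyMeasurable).symm
  rw [setIntegral_withDensity_eq_setIntegral_smul hd₀ _ (hm A hA),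
    setIntegral_withDensity_eq_setIntegral_smul hd₀ _ (hm A hA), ← setIntegral_condExp hm hdf hA]
  exact setIntegral_congr_ae (hm A hA) (hpull.mono fun x hx _ => hx.symm)

theorem ext_of_integral_prod_boundedContinuousFunction {ι : Type*} [Fintype ι] {X : ι → Type*}
    [∀ i, TopologicalSpace (X i)] [∀ i, MeasurableSpace (X i)] [∀ i, BorelSpace (X i)]
    [∀ i, HasOuterApproxClosed (X i)] {μ ν : Measure (Π i, X i)} [IsFiniteMeasure μ]
    [IsFiniteMeasure ν] (h : ∀ f : Π i, BoundedContinuousFunction (X i) ℝ,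
      ∫ x, ∏ i, f i (x i) ∂μ = ∫ x, ∏ i, f i (x i) ∂ν) : μ = ν := by
  have hpair : Measurable fun x : Π i, X i => (x, ()) := by fun_prop
  have hmap : μ.map (fun x => (x, ())) = ν.map (fun x => (x, ())) := by
    refine Measure.ext_of_integral_prod_mul_boundedContinuousFunction fun f g => ?_
    have hmeas : Measurable fun p : (Π i, X i) × Unit => (∏ i, f i (p.1 i)) * g p.2 := by
      fun_prop
    rw [integral_map hpair.aemeasurable hmeas.aestronglyMeasurable,
      integral_map hpair.aemeasurable hmeas.aestronglyMeasurable]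
    simp only [integral_mul_const, h]
  simpa only [Measure.map_map measurable_fst hpair, Function.comp_def, Measure.map_id'] using
    congrArg (Measure.map Prod.fst) hmap

end Densities

namespace FellerTransition

variable {E : Type*} [MetricSpace E] [CompactSpace E] [MeasurableSpace E] [BorelSpace E]
  {T : FellerTransition E} {μ : Measure E} {P P' : Measure (CadlagPath E)} {a b : ℝ≥0}

theorem stronglyMeasurable_eval (hab : a ≤ b) :
    StronglyMeasurable[pathFiltration E b] (eval a : CadlagPath E → E) :=
  (Filtration.stronglyAdapted_natural
    (fun t => (measurable_eval (E := E) t).stronglyMeasurable) a).mono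
    ((pathFiltration E).mono hab)

theorem stronglyMeasurable_continuousMap_eval (G : C(E, ℝ)) (hab : a ≤ b) :
    StronglyMeasurable[pathFiltration E b] fun X : CadlagPath E => G (X.eval a) :=
  G.continuous.comp_stronglyMeasurable (stronglyMeasurable_eval hab)

omit [CompactSpace E] in
theorem measurable_continuousMap_eval (G : C(E, ℝ)) (a : ℝ≥0) :
    Measurable fun X : CadlagPath E => G (X.eval a) :=
  G.continuous.measurable.comp (measurable_eval a)

theorem integrable_mul_eval {W : CadlagPath E → ℝ} (hW : Integrable W P) (G : C(E, ℝ)) (a : ℝ≥0) :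
    Integrable (fun X => W X * G (X.eval a)) P :=
  hW.mul_bdd (c := ‖G‖) (measurable_continuousMap_eval G a).aestronglyMeasurable
    (Eventually.of_forall fun _ => G.norm_coe_le_norm _)

theorem integrable_continuousMap_eval [IsFiniteMeasure P] (G : C(E, ℝ)) (a : ℝ≥0) :
    Integrable (fun X => G (X.eval a)) P := by
  simpa using integrable_mul_eval (integrable_const (1 : ℝ)) G a

theorem integrable_prod_eval [IsFiniteMeasure P] (I : Finset ℝ≥0) (f : ℝ≥0 → C(E, ℝ)) :
    Integrable (fun X : CadlagPath E => ∏ i ∈ I, f i (X.eval i)) P := by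
  classical
  induction I using Finset.induction_on with
  | empty => simp
  | insert a I ha ih =>
    simpa only [Finset.prod_insert ha, mul_comm] using integrable_mul_eval ih (f a) a

namespace IsMarkovMeasure

theorem integral_mul_eval (hP : T.IsMarkovMeasure μ P) (hab : a ≤ b) {W : CadlagPath E → ℝ}
    (hW : StronglyMeasurable[pathFiltration E a] W) (hWi : Integrable W P) (G : C(E, ℝ)) :
    ∫ X, W X * G (X.eval b) ∂P = ∫ X, W X * T.S (b - a) G (X.eval a) ∂P := by
  have := hP.isProb
  have hpull := condExp_mul_of_stronglyMeasurable_left (μ := P) hW (integrable_mul_eval hWi G b)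
    (integrable_continuousMap_eval G b)
  have hmarkov := hP.markov a (b - a) G
  rw [add_tsub_cancel_of_le hab] at hmarkov
  refine (integral_condExp ((pathFiltration E).le a)).symm.trans (integral_congr_ae ?_)
  filter_upwards [hpull, hmarkov] with X hpullX hmarkovX
  exact hpullX.trans (congrArg (W X * ·) hmarkovX)

theorem integral_mul_mul_eval (hP : T.IsMarkovMeasure μ P) (hab : a ≤ b) (G₀ G₁ G₂ : C(E, ℝ)) :
    ∫ X, G₀ (X.eval 0) * G₁ (X.eval a) * G₂ (X.eval b) ∂P
      = ∫ x, (G₀ * T.S a (G₁ * T.S (b - a) G₂)) x ∂μ := by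
  have := hP.isProb
  have hlast := hP.integral_mul_eval hab ((stronglyMeasurable_continuousMap_eval G₀ zero_le).mul
    (stronglyMeasurable_continuousMap_eval G₁ le_rfl)) (integrable_mul_eval
    (integrable_continuousMap_eval G₀ 0) G₁ a) G₂
  have hfirst := hP.integral_mul_eval (zero_le : 0 ≤ a)
    (stronglyMeasurable_continuousMap_eval G₀ le_rfl) (integrable_continuousMap_eval G₀ 0)
    (G₁ * T.S (b - a) G₂)
  simp only [ContinuousMap.mul_apply, ← mul_assoc, tsub_zero] at hfirst
  refine (hlast.trans hfirst).trans ?_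
  rw [← hP.initial, integral_map (measurable_eval 0).aemeasurable
    (ContinuousMap.continuous _).aestronglyMeasurable]
  rfl

theorem integral_prod_mul_eval_eq (hP : T.IsMarkovMeasure μ P) (hP' : T.IsMarkovMeasure μ P')
    (f : ℝ≥0 → C(E, ℝ)) (I : Finset ℝ≥0) : ∀ {b : ℝ≥0}, (∀ i ∈ I, i ≤ b) → ∀ G : C(E, ℝ),
      ∫ X, (∏ i ∈ I, f i (X.eval i)) * G (X.eval b) ∂P
        = ∫ X, (∏ i ∈ I, f i (X.eval i)) * G (X.eval b) ∂P' := by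
  classical
  induction I using Finset.induction_on_max with
  | empty =>
    intro b _ G
    have heval {Q : Measure (CadlagPath E)} (hQ : T.IsMarkovMeasure μ Q) :=
      hQ.integral_mul_mul_eval (zero_le : 0 ≤ b) 1 1 G
    simpa using (heval hP).trans (heval hP').symm
  | insert a I hI ih =>
    intro b hb G
    have ha : a ∉ I := fun hmem => (hI a hmem).false
    have hstep {Q : Measure (CadlagPath E)} (hQ : T.IsMarkovMeasure μ Q) :
        ∫ X, (∏ i ∈ insert a I, f i (X.eval i)) * G (X.eval b) ∂Q
          = ∫ X, (∏ i ∈ I, f i (X.eval i)) * (f a * T.S (b - a) G) (X.eval a) ∂Q := by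
      have := hQ.isProb
      rw [hQ.integral_mul_eval (hb a (Finset.mem_insert_self a I))
        (Finset.stronglyMeasurable_fun_prod _ fun i hi =>
          stronglyMeasurable_continuousMap_eval (f i) ?_) (integrable_prod_eval _ f)]
      · simp only [Finset.prod_insert ha, ContinuousMap.mul_apply, mul_comm (f a _), mul_assoc]
      · exact (Finset.mem_insert.1 hi).elim (·.le) fun hi => (hI i hi).le
    rw [hstep hP, hstep hP', ih fun i hi => (hI i hi).le]

theorem map_restrict_eq (hP : T.IsMarkovMeasure μ P) (hP' : T.IsMarkovMeasure μ P')
    (I : Finset ℝ≥0) :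
    P.map (fun X (i : I) => X.eval i) = P'.map (fun X (i : I) => X.eval i) := by
  classical
  have := hP.isProb
  have := hP'.isProb
  have hmeas : Measurable fun (X : CadlagPath E) (i : I) => X.eval i :=
    measurable_pi_lambda _ fun i => measurable_eval i
  refine ext_of_integral_prod_boundedContinuousFunction fun f => ?_
  have hprod : Measurable fun x : I → E => ∏ i, f i (x i) := by fun_prop
  rw [integral_map hmeas.aemeasurable hprod.aestronglyMeasurable,
    integral_map hmeas.aemeasurable hprod.aestronglyMeasurable]
  have hext (X : CadlagPath E) : ∏ i : I, f i (X.eval i)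
      = ∏ i ∈ I, (if hi : i ∈ I then (f ⟨i, hi⟩).toContinuousMap else 0) (X.eval i) := by
    rw [← Finset.prod_coe_sort I]
    exact Finset.prod_congr rfl fun i _ => by rw [dif_pos i.2]; rfl
  obtain ⟨b, hb⟩ := I.bddAbove
  simpa only [hext, ContinuousMap.one_apply, mul_one] using
    hP.integral_prod_mul_eval_eq hP' _ I (fun i hi => hb hi) 1

theorem unique (hP : T.IsMarkovMeasure μ P) (hP' : T.IsMarkovMeasure μ P') : P = P' := by
  have := hP'.isProb
  let path (X : CadlagPath E) (r : ℝ≥0) : E := X.eval r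
  have hpath : Measurable path := measurable_subtype_coe
  have hfin (I : Finset ℝ≥0) : (P.map path).map I.restrict = (P'.map path).map I.restrict := by
    rw [Measure.map_map (Finset.measurable_restrict I) hpath,
      Measure.map_map (Finset.measurable_restrict I) hpath]
    exact hP.map_restrict_eq hP' I
  have hmap : P.map path = P'.map path :=
    IsProjectiveLimit.unique (P := fun I : Finset ℝ≥0 => (P'.map path).map I.restrict) hfin
      fun _ => rfl
  ext s ⟨B, hB, hs⟩
  change path ⁻¹' B = s at hs
  rw [← hs, ← Measure.map_apply hpath hB, hmap, Measure.map_apply hpath hB]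

theorem withDensity (hP : T.IsMarkovMeasure μ P) {d : CadlagPath E → ℝ≥0}
    (hd : Measurable[pathFiltration E 0] d)
    [IsProbabilityMeasure (P.withDensity fun X => (d X : ℝ≥0∞))] :
    T.IsMarkovMeasure ((P.withDensity fun X => (d X : ℝ≥0∞)).map (eval 0))
      (P.withDensity fun X => (d X : ℝ≥0∞)) where
  isProb := inferInstance
  initial := rfl
  markov s r f := by
    have := hP.isProb
    exact (condExp_withDensity ((pathFiltration E).le s)
      (hd.mono ((pathFiltration E).mono zero_le) le_rfl) (integrable_continuousMap_eval f _)
      (integrable_continuousMap_eval f _)).trans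
      ((withDensity_absolutelyContinuous _ _).ae_eq (hP.markov s r f))

end IsMarkovMeasure

end FellerTransition

section RelativeEntropy

variable {α β : Type*} [MeasurableSpace α] [MeasurableSpace β]

theorem llr_withDensity {P : Measure α} [SigmaFinite P] {d : α → ℝ≥0} (hd : Measurable d) :
    llr (P.withDensity fun x => (d x : ℝ≥0∞)) P
      =ᵐ[P.withDensity fun x => (d x : ℝ≥0∞)] fun x => Real.log (d x) := by
  filter_upwards [(withDensity_absolutelyContinuous P _).ae_eq
    (P.rnDeriv_withDensity hd.coe_nnreal_ennreal)] with x hx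
  rw [llr, hx, ENNReal.coe_toReal]

theorem llr_withDensity_exp {P : Measure α} [SigmaFinite P] {ψ : α → ℝ} (hψ : Measurable ψ) :
    llr (P.withDensity fun x => ENNReal.ofReal (Real.exp (ψ x))) P
      =ᵐ[P.withDensity fun x => ENNReal.ofReal (Real.exp (ψ x))] ψ := by
  filter_upwards [llr_withDensity (P := P) hψ.exp.real_toNNReal] with x hx
  refine hx.trans ?_
  rw [Real.coe_toNNReal _ (Real.exp_pos _).le, Real.log_exp]

theorem klDiv_withDensity_exp {P Q : Measure α} [IsProbabilityMeasure P] [IsProbabilityMeasure Q]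
    {ψ : α → ℝ} (hψ : Measurable ψ)
    (hQ : Q = P.withDensity fun x => ENNReal.ofReal (Real.exp (ψ x))) (hint : Integrable ψ Q) :
    klDiv Q P = ENNReal.ofReal (∫ x, ψ x ∂Q) := by
  subst hQ
  have hllr := llr_withDensity_exp (P := P) hψ
  rw [klDiv_of_ac_of_integrable (withDensity_absolutelyContinuous _ _)
    (hint.congr hllr.symm), integral_congr_ae hllr, probReal_univ, probReal_univ,
    add_sub_cancel_right]

theorem map_withDensity_comp {P : Measure α} {φ : α → β} (hφ : Measurable φ) {d : β → ℝ≥0∞}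
    (hd : Measurable d) : (P.withDensity (d ∘ φ)).map φ = (P.map φ).withDensity d := by
  ext B hB
  rw [Measure.map_apply hφ hB, withDensity_apply _ (hφ hB), withDensity_apply _ hB,
    setLIntegral_map hB hd hφ]
  rfl

theorem llr_eq_log_add_llr {P Q : Measure α} [SigmaFinite P] [SigmaFinite Q] {d : α → ℝ≥0}
    (hd : Measurable d) (hac : Q ≪ P.withDensity fun x => (d x : ℝ≥0∞)) :
    llr Q P =ᵐ[Q] fun x =>
      Real.log (d x) + llr Q (P.withDensity fun x => (d x : ℝ≥0∞)) x := by
  have : SigmaFinite (P.withDensity fun x => (d x : ℝ≥0∞)) := SigmaFinite.withDensity d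
  have hacP := withDensity_absolutelyContinuous P fun x => (d x : ℝ≥0∞)
  have hdP := P.rnDeriv_withDensity hd.coe_nnreal_ennreal
  filter_upwards [(hac.trans hacP).ae_le (Measure.rnDeriv_mul_rnDeriv hac),
    (hac.trans hacP).ae_le hdP, hac.ae_le (Measure.rnDeriv_pos hacP), Measure.rnDeriv_pos hac,
    hac.ae_le (Measure.rnDeriv_lt_top Q (P.withDensity fun x => (d x : ℝ≥0∞)))]
    with x hmul hdx hdpos hpos hlt
  rw [hdx] at hdpos
  rw [llr, llr, ← hmul, Pi.mul_apply, hdx, ENNReal.toReal_mul, ENNReal.coe_toReal, add_comm,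
    Real.log_mul (ENNReal.toReal_pos hpos.ne' hlt.ne).ne'
      (NNReal.coe_ne_zero.2 (ENNReal.coe_ne_zero.1 hdpos.ne'))]

theorem klDiv_eq_klDiv_map_add_klDiv {P P' Q : Measure α} [IsFiniteMeasure P] [IsFiniteMeasure P']
    [IsFiniteMeasure Q] {φ : α → β} (hφ : Measurable φ) {d : β → ℝ≥0} (hd : Measurable d)
    (hP' : P' = P.withDensity fun x => (d (φ x) : ℝ≥0∞)) (hac : Q ≪ P')
    (hmap : Q.map φ = P'.map φ) (hint : Integrable (llr Q P') Q) :
    klDiv Q P = klDiv (Q.map φ) (P.map φ) + klDiv Q P' := by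
  have hacP : Q ≪ P := hac.trans (hP' ▸ withDensity_absolutelyContinuous _ _)
  have hlog : AEStronglyMeasurable (fun y => Real.log (d y)) (Q.map φ) :=
    hd.coe_nnreal_real.log.aestronglyMeasurable
  have hllr : llr Q P =ᵐ[Q] fun x => Real.log (d (φ x)) + llr Q P' x := by
    subst hP'
    exact llr_eq_log_add_llr (hd.comp hφ) hac
  have hllr_map : llr (Q.map φ) (P.map φ) =ᵐ[Q.map φ] fun y => Real.log (d y) := by
    have hmap_d : Q.map φ = (P.map φ).withDensity fun y => (d y : ℝ≥0∞) := by
      rw [hmap, hP']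
      exact map_withDensity_comp hφ hd.coe_nnreal_ennreal
    exact hmap_d ▸ llr_withDensity hd
  have hmass : P'.real Set.univ = Q.real Set.univ := by
    simpa only [map_measureReal_apply hφ .univ, Set.preimage_univ] using
      congrArg (fun ν : Measure β => ν.real Set.univ) hmap.symm
  have hintP_iff : Integrable (llr Q P) Q ↔ Integrable (fun x => Real.log (d (φ x))) Q :=
    (integrable_congr hllr).trans (integrable_add_iff_integrable_left' hint)
  have hint_map_iff : Integrable (llr (Q.map φ) (P.map φ)) (Q.map φ) ↔
      Integrable (fun x => Real.log (d (φ x))) Q :=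
    (integrable_congr hllr_map).trans (integrable_map_measure hlog hφ.aemeasurable)
  by_cases hlogint : Integrable (fun x => Real.log (d (φ x))) Q
  · have hint_map := hint_map_iff.2 hlogint
    rw [klDiv_of_ac_of_integrable hacP (hintP_iff.2 hlogint),
      klDiv_of_ac_of_integrable (hacP.map hφ) hint_map, klDiv_of_ac_of_integrable hac hint,
      ← ENNReal.ofReal_add (integral_llr_add_sub_measure_univ_nonneg (hacP.map hφ) hint_map)
        (integral_llr_add_sub_measure_univ_nonneg hac hint), integral_congr_ae hllr,
      integral_add hlogint hint, integral_congr_ae hllr_map, integral_map hφ.aemeasurable hlog,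
      map_measureReal_apply hφ .univ, map_measureReal_apply hφ .univ, hmass, Set.preimage_univ,
      add_sub_cancel_right, add_right_comm, add_sub_right_comm]
  · rw [klDiv_of_not_integrable (mt hintP_iff.1 hlogint),
      klDiv_of_not_integrable (mt hint_map_iff.1 hlogint), top_add]

end RelativeEntropy

section DoobTransform

variable {E : Type*} [MetricSpace E] [CompactSpace E] [MeasurableSpace E] [BorelSpace E]
  {T : FellerTransition E} {μ : Measure E} {P Q : Measure (CadlagPath E)} {t : ℝ≥0} {h : C(E, ℝ)}
  {ρ₀ : E → ℝ≥0}

/-- The Doob transform of a path measure by `h` at time `t`, normalized so that the initial law of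
a Markov measure does not change. -/
def doobTransform (T : FellerTransition E) (h : C(E, ℝ)) (t : ℝ≥0) (P : Measure (CadlagPath E)) :
    Measure (CadlagPath E) :=
  P.withDensity fun X => ENNReal.ofReal (Real.exp (h (X.eval t) - T.V t h (X.eval 0)))

theorem measurable_sub_V_eval (T : FellerTransition E) (h : C(E, ℝ)) (t : ℝ≥0) :
    Measurable fun X : CadlagPath E => h (X.eval t) - T.V t h (X.eval 0) :=
  (measurable_continuousMap_eval h t).sub (measurable_continuousMap_eval (T.V t h) 0)

theorem integral_eval_doobTransform (hP : T.IsMarkovMeasure μ P) (h : C(E, ℝ)) (t s : ℝ≥0)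
    (F : C(E, ℝ)) :
    ∫ X, F (X.eval s) ∂doobTransform T h t P
      = ∫ x, (expC (-T.V t h)
          * T.S (min s t) (T.S (s - t) F * expC (T.V (t - s) h))) x ∂μ := by
  rw [doobTransform, integral_withDensity_eq_integral_toReal_smul
    (measurable_sub_V_eval T h t).exp.ennreal_ofReal
    (Eventually.of_forall fun _ => ENNReal.ofReal_lt_top)]
  simp only [ENNReal.toReal_ofReal (Real.exp_pos _).le, smul_eq_mul]
  simp only [sub_eq_neg_add, Real.exp_add]
  rcases le_total s t with hst | hst
  · rw [min_eq_left hst, tsub_eq_zero_of_le hst, S_zero, expC_V,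
      ← hP.integral_mul_mul_eval hst]
    simp only [expC_apply, ContinuousMap.neg_apply, mul_right_comm]
  · rw [min_eq_right hst, tsub_eq_zero_of_le hst, V_zero, mul_comm (T.S _ F),
      ← hP.integral_mul_mul_eval hst]
    simp only [expC_apply, ContinuousMap.neg_apply]

omit [CompactSpace E] in
theorem integral_law [IsProbabilityMeasure Q] (s : ℝ≥0) (F : C(E, ℝ)) :
    ∫ x, F x ∂(law Q s : Measure E) = ∫ X, F (X.eval s) ∂Q :=
  integral_map (measurable_eval s).aemeasurable F.continuous.aestronglyMeasurable

theorem law_doobTransform_zero (hP : T.IsMarkovMeasure μ P) [IsProbabilityMeasure Q]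
    (hQ : Q = doobTransform T h t P) : (law Q 0 : Measure E) = μ := by
  have := hP.isProb
  have : IsProbabilityMeasure μ :=
    hP.initial ▸ Measure.isProbabilityMeasure_map (measurable_eval 0).aemeasurable
  refine ext_of_forall_integral_eq_of_IsFiniteMeasure fun F => ?_
  have hlaw := integral_law (Q := Q) 0 F.toContinuousMap
  subst hQ
  rw [integral_eval_doobTransform hP, zero_min, zero_tsub, tsub_zero] at hlaw
  simp only [S_zero, mul_left_comm, expC_neg_mul_expC, mul_one] at hlaw
  exact hlaw

theorem isDoobCurve_law (hP : T.IsMarkovMeasure μ P) [IsProbabilityMeasure Q]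
    (hQ : Q = doobTransform T h t P) : IsDoobCurve T h t (law Q) := fun s F => by
  rw [integral_law, law_doobTransform_zero hP hQ, hQ, integral_eval_doobTransform hP]

theorem klDiv_doobTransform [IsProbabilityMeasure P] [IsProbabilityMeasure Q]
    (hQ : Q = doobTransform T h t P) :
    klDiv Q P = ENNReal.ofReal (∫ x, h x ∂(law Q t : Measure E)
      - ∫ x, T.V t h x ∂(law Q 0 : Measure E)) := by
  have hint : Integrable (fun X : CadlagPath E => h (X.eval t) - T.V t h (X.eval 0)) Q :=
    (integrable_continuousMap_eval h t).sub (integrable_continuousMap_eval _ 0)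
  rw [integral_law, integral_law, ← integral_sub (integrable_continuousMap_eval h t)
    (integrable_continuousMap_eval _ 0)]
  exact klDiv_withDensity_exp (measurable_sub_V_eval T h t) hQ hint

/-- The density with respect to `P₀` of the initial law of the path measure with density
`ρ₀ (X 0) * exp (h (X t))` with respect to the Markov measure started from `P₀`. -/
def doobInitialDensity (T : FellerTransition E) (h : C(E, ℝ)) (t : ℝ≥0) (ρ₀ : E → ℝ≥0) (x : E) :
    ℝ≥0 :=
  ρ₀ x * (Real.exp (T.V t h x)).toNNReal

theorem measurable_doobInitialDensity (hρ₀ : Measurable ρ₀) :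
    Measurable (doobInitialDensity T h t ρ₀) :=
  hρ₀.mul (T.V t h).continuous.measurable.exp.real_toNNReal

theorem doobTransform_withDensity (hρ₀ : Measurable ρ₀) :
    doobTransform T h t
        (P.withDensity fun X => (doobInitialDensity T h t ρ₀ (X.eval 0) : ℝ≥0∞))
      = P.withDensity fun X =>
        (ρ₀ (X.eval 0) : ℝ≥0∞) * ENNReal.ofReal (Real.exp (h (X.eval t))) := by
  have hdensity : Measurable fun X : CadlagPath E =>
      (doobInitialDensity T h t ρ₀ (X.eval 0) : ℝ≥0∞) :=
    ((measurable_doobInitialDensity hρ₀).comp (measurable_eval 0)).coe_nnreal_ennreal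
  rw [doobTransform, ← withDensity_mul _ hdensity (measurable_sub_V_eval T h t).exp.ennreal_ofReal]
  congr 1 with X
  change (doobInitialDensity T h t ρ₀ (X.eval 0) : ℝ≥0∞) * _ = _
  rw [doobInitialDensity, ENNReal.coe_mul, mul_assoc, ← ENNReal.ofReal,
    ← ENNReal.ofReal_mul (Real.exp_pos _).le, ← Real.exp_add, add_sub_cancel]

theorem integrable_initial_of_isProbabilityMeasure (hρ₀ : Measurable ρ₀)
    [IsProbabilityMeasure (P.withDensity fun X =>
      (ρ₀ (X.eval 0) : ℝ≥0∞) * ENNReal.ofReal (Real.exp (h (X.eval t))))] :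
    Integrable (fun X => (ρ₀ (X.eval 0) : ℝ)) P := by
  have hdensity : Measurable fun X : CadlagPath E =>
      (ρ₀ (X.eval 0) : ℝ≥0∞) * ENNReal.ofReal (Real.exp (h (X.eval t))) :=
    (hρ₀.comp (measurable_eval 0)).coe_nnreal_ennreal.mul
      (measurable_continuousMap_eval h t).exp.ennreal_ofReal
  have hint := (integrable_withDensity_iff_integrable_smul' hdensity
    (Eventually.of_forall fun X => ENNReal.mul_lt_top ENNReal.coe_lt_top ENNReal.ofReal_lt_top)).1
    (integrable_continuousMap_eval (P := P.withDensity fun X =>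
      (ρ₀ (X.eval 0) : ℝ≥0∞) * ENNReal.ofReal (Real.exp (h (X.eval t)))) (expC (-h)) t)
  simpa only [ENNReal.toReal_mul, ENNReal.coe_toReal, ENNReal.toReal_ofReal (Real.exp_pos _).le,
    expC_apply, ContinuousMap.neg_apply, smul_eq_mul, mul_assoc, ← Real.exp_add, add_neg_cancel,
    Real.exp_zero, mul_one] using hint

theorem isProbabilityMeasure_withDensity_doobInitialDensity (hP : T.IsMarkovMeasure μ P)
    (hρ₀ : Measurable ρ₀)
    [hprob : IsProbabilityMeasure (P.withDensity fun X =>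
      (ρ₀ (X.eval 0) : ℝ≥0∞) * ENNReal.ofReal (Real.exp (h (X.eval t))))] :
    IsProbabilityMeasure
      (P.withDensity fun X => (doobInitialDensity T h t ρ₀ (X.eval 0) : ℝ≥0∞)) := by
  have hint := integrable_initial_of_isProbabilityMeasure (P := P) (h := h) (t := t) hρ₀
  have hmarkov := hP.integral_mul_eval (zero_le : 0 ≤ t)
    (hρ₀.coe_nnreal_real.stronglyMeasurable.comp_measurable
      (stronglyMeasurable_eval le_rfl).measurable) hint (expC h)
  rw [tsub_zero, ← expC_V] at hmarkov
  have hcoe {G : C(E, ℝ)} {s : ℝ≥0} :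
      ∫⁻ X, (ρ₀ (X.eval 0) : ℝ≥0∞) * ENNReal.ofReal (Real.exp (G (X.eval s))) ∂P
        = ENNReal.ofReal (∫ X, (ρ₀ (X.eval 0) : ℝ) * expC G (X.eval s) ∂P) := by
    rw [ofReal_integral_eq_lintegral_ofReal (integrable_mul_eval hint _ _)
      (Eventually.of_forall fun X => mul_nonneg (ρ₀ _).2 (Real.exp_pos _).le)]
    simp only [ENNReal.ofReal_mul (NNReal.coe_nonneg _), ENNReal.ofReal_coe_nnreal, expC_apply]
  refine isProbabilityMeasure_iff.2 ?_
  rw [← hprob.measure_univ, withDensity_apply _ .univ, withDensity_apply _ .univ,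
    setLIntegral_univ, setLIntegral_univ, hcoe]
  refine Eq.trans ?_ (congrArg ENNReal.ofReal hmarkov.symm)
  refine Eq.trans ?_ hcoe
  simp only [doobInitialDensity, ENNReal.coe_mul]
  rfl

theorem isMarkovMeasure_law_zero (hP : T.IsMarkovMeasure μ P) (hρ₀ : Measurable ρ₀)
    [IsProbabilityMeasure Q] (hQ : Q = P.withDensity fun X =>
      (ρ₀ (X.eval 0) : ℝ≥0∞) * ENNReal.ofReal (Real.exp (h (X.eval t)))) :
    T.IsMarkovMeasure (law Q 0 : Measure E)
      (P.withDensity fun X => (doobInitialDensity T h t ρ₀ (X.eval 0) : ℝ≥0∞)) := by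
  subst hQ
  have := isProbabilityMeasure_withDensity_doobInitialDensity (h := h) (t := t) hP hρ₀
  let d (X : CadlagPath E) : ℝ≥0 := doobInitialDensity T h t ρ₀ (X.eval 0)
  have hd : Measurable[pathFiltration E 0] d :=
    (measurable_doobInitialDensity hρ₀).comp (stronglyMeasurable_eval le_rfl).measurable
  have hP' := hP.withDensity hd
  rwa [← law_doobTransform_zero hP' (doobTransform_withDensity hρ₀).symm] at hP'

theorem klDiv_eq_klDiv_law_zero_add (hP : T.IsMarkovMeasure μ P) (hρ₀ : Measurable ρ₀)
    [IsProbabilityMeasure Q] (hQ : Q = P.withDensity fun X =>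
      (ρ₀ (X.eval 0) : ℝ≥0∞) * ENNReal.ofReal (Real.exp (h (X.eval t)))) :
    klDiv Q P = klDiv (law Q 0 : Measure E) μ + klDiv Q
      (P.withDensity fun X => (doobInitialDensity T h t ρ₀ (X.eval 0) : ℝ≥0∞)) := by
  have hP' := isMarkovMeasure_law_zero hP hρ₀ hQ
  have := hP.isProb
  have := hP'.isProb
  rw [← doobTransform_withDensity (T := T) hρ₀] at hQ
  have hllr := llr_withDensity_exp (P := P.withDensity fun X =>
    (doobInitialDensity T h t ρ₀ (X.eval 0) : ℝ≥0∞)) (measurable_sub_V_eval T h t)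
  rw [← doobTransform, ← hQ] at hllr
  rw [← hP.initial]
  exact klDiv_eq_klDiv_map_add_klDiv (measurable_eval 0) (measurable_doobInitialDensity hρ₀) rfl
    (hQ ▸ withDensity_absolutelyContinuous _ _) hP'.initial.symm
    (((integrable_continuousMap_eval h t).sub (integrable_continuousMap_eval _ 0)).congr hllr.symm)

end DoobTransform

end DoobEntropy

end

theorem mainTheorem9_general {E : Type*} [MetricSpace E] [CompactSpace E] [MeasurableSpace E]
    [BorelSpace E] (T : DoobEntropy.FellerTransition E)
    (D : Submodule ℝ C(E, ℝ)) [TopologicalSpace (DoobEntropy.CoreSpace D)]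
    [TopologicalSpace.SeparableSpace (DoobEntropy.CoreSpace D)]
    (hD : DoobEntropy.IsTopologicalDomain T D)
    (P₀ : Measure E) (P : Measure (DoobEntropy.CadlagPath E)) (hP : T.IsMarkovMeasure P₀ P)
    (t : ℝ≥0) (h : C(E, ℝ)) (hh : h ∈ D) (ρ₀ : E → ℝ≥0) (hρ₀ : Measurable ρ₀)
    (Q : Measure (DoobEntropy.CadlagPath E)) [IsProbabilityMeasure Q]
    (hQ : Q = P.withDensity fun X =>
      (ρ₀ (X.eval 0) : ℝ≥0∞) * ENNReal.ofReal (Real.exp (h (X.eval t)))) :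
    (∃ P' : Measure (DoobEntropy.CadlagPath E),
      T.IsMarkovMeasure (DoobEntropy.CadlagPath.law Q 0 : Measure E) P') ∧
    (∀ P' : Measure (DoobEntropy.CadlagPath E),
      T.IsMarkovMeasure (DoobEntropy.CadlagPath.law Q 0 : Measure E) P' →
        InformationTheory.klDiv Q P
          = InformationTheory.klDiv (DoobEntropy.CadlagPath.law Q 0 : Measure E) P₀
            + InformationTheory.klDiv Q P') ∧
    DoobEntropy.IsAbsolutelyContinuousCurve D (DoobEntropy.CadlagPath.law Q) ∧
    (∀ γ' : ℝ≥0 → DoobEntropy.CoreSpace D →L[ℝ] ℝ,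
      DoobEntropy.IsDerivativeOf γ' (DoobEntropy.CadlagPath.law Q) →
        InformationTheory.klDiv Q P
          = InformationTheory.klDiv (DoobEntropy.CadlagPath.law Q 0 : Measure E) P₀
            + DoobEntropy.lagrangianCost T (DoobEntropy.CadlagPath.law Q) γ' t) := by
  have hP' := DoobEntropy.isMarkovMeasure_law_zero hP hρ₀ hQ
  have := hP'.isProb
  have hQ' := hQ.trans (DoobEntropy.doobTransform_withDensity (T := T) hρ₀).symm
  have hγ := DoobEntropy.isDoobCurve_law hP' hQ'
  have hchain := DoobEntropy.klDiv_eq_klDiv_law_zero_add hP hρ₀ hQ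
  refine ⟨⟨_, hP'⟩, fun P'' hP'' => hP''.unique hP' ▸ hchain,
    hγ.isAbsolutelyContinuousCurve hD hh, fun γ' hγ' => ?_⟩
  rw [hchain, DoobEntropy.klDiv_doobTransform hQ', hγ.lagrangianCost_eq hD hh hγ']

theorem mainTheorem9 {E : Type*} [MetricSpace E] [CompactSpace E] [MeasurableSpace E]
    [BorelSpace E] (T : DoobEntropy.FellerTransition E)
    (D : Submodule ℝ C(E, ℝ)) [TopologicalSpace (DoobEntropy.CoreSpace D)]
    (hD : DoobEntropy.IsTopologicalCore T D)
    (P₀ : Measure E) (P : Measure (DoobEntropy.CadlagPath E)) (hP : T.IsMarkovMeasure P₀ P)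
    (t : ℝ≥0) (h : C(E, ℝ)) (hh : h ∈ D) (ρ₀ : E → ℝ≥0) (hρ₀ : Measurable ρ₀)
    (Q : Measure (DoobEntropy.CadlagPath E)) [IsProbabilityMeasure Q]
    (hQ : Q = P.withDensity fun X =>
      (ρ₀ (X.eval 0) : ℝ≥0∞) * ENNReal.ofReal (Real.exp (h (X.eval t)))) :
    (∃ P' : Measure (DoobEntropy.CadlagPath E),
      T.IsMarkovMeasure (DoobEntropy.CadlagPath.law Q 0 : Measure E) P') ∧
    (∀ P' : Measure (DoobEntropy.CadlagPath E),
      T.IsMarkovMeasure (DoobEntropy.CadlagPath.law Q 0 : Measure E) P' →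
        InformationTheory.klDiv Q P
          = InformationTheory.klDiv (DoobEntropy.CadlagPath.law Q 0 : Measure E) P₀
            + InformationTheory.klDiv Q P') ∧
    DoobEntropy.IsAbsolutelyContinuousCurve D (DoobEntropy.CadlagPath.law Q) ∧
    (∀ γ' : ℝ≥0 → DoobEntropy.CoreSpace D →L[ℝ] ℝ,
      DoobEntropy.IsDerivativeOf γ' (DoobEntropy.CadlagPath.law Q) →
        InformationTheory.klDiv Q P
          = InformationTheory.klDiv (DoobEntropy.CadlagPath.law Q 0 : Measure E) P₀
            + DoobEntropy.lagrangianCost T (DoobEntropy.CadlagPath.law Q) γ' t) :=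
  have := hD.separable
  mainTheorem9_general T D hD.isTopologicalDomain P₀ P hP t h hh ρ₀ hρ₀ Q hQ
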